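/- Let $n\ge 1$ and let $K,L\subseteq\mathbb R^n$ be convex bodies, i.e. compact convex sets with non-empty interior. Write $|\cdot|$ for $n$-dimensional Lebesgue measure, $M(K,L)=\max_{z\in\mathbb R^n}|K\cap(z-L)|$, and, for $0\le\theta\le 1$, $$K+_\theta L:=\{z\in K+L \,:\, |K\cap(z-L)|\ge\theta\,M(K,L)\}.$$ Then for every $\left(\frac34\right)^n\le\theta\le 1$ $$|K+_\theta L|^{\frac1n}\ \ge\ \frac12\binom{2n}{n}^{\frac1n}\left(1-\theta^{\frac1n}\right)\left(|K|^{\frac1n}+|L|^{\frac1n}\right),$$ and for every $0\le\theta\le\left(\frac34\right)^n$ $$|K+_\theta L|^{\frac1n}\ \ge\ \left(1-\left(\frac43-\frac16\binom{2n}{n}^{\frac1n}\right)\theta^{\frac1n}\right)\left(|K|^{\frac1n}+|L|^{\frac1n}\right).$$ Moreover, for any given $\left(\frac34\right)^n\le\theta<1$, equality holds in the first inequality if and only if $K$ is an $n$-dimensional simplex and $K=x-L$ for some $x\in\mathbb R^n$ (that is, up to a translation, $K=-L$ is an $n$-dimensional simplex). -/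

import Mathlib

open scoped Pointwise

noncomputable section

/-- `n`-dimensional Lebesgue measure `|A|` of a set `A` in `ℝⁿ`, as a real number. -/
def vol {n : ℕ} (A : Set (EuclideanSpace ℝ (Fin n))) : ℝ :=
  (MeasureTheory.volume A).toReal

/-- `M(K, L)`, the maximum over `z` of `|K ∩ (z - L)|`. -/
def maxIntersectionVol {n : ℕ} (K L : Set (EuclideanSpace ℝ (Fin n))) : ℝ :=
  ⨆ z : EuclideanSpace ℝ (Fin n), vol (K ∩ ({z} - L))

/-- The `θ`-convolution body `K +_θ L`. -/
def thetaConvolution {n : ℕ} (θ : ℝ) (K L : Set (EuclideanSpace ℝ (Fin n))) :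
    Set (EuclideanSpace ℝ (Fin n)) :=
  {z | z ∈ K + L ∧ θ * maxIntersectionVol K L ≤ vol (K ∩ ({z} - L))}

/-- `K` is an `n`-dimensional simplex in `ℝⁿ`: the convex hull of `n + 1` affinely independent
points. -/
def IsFullSimplex {n : ℕ} (K : Set (EuclideanSpace ℝ (Fin n))) : Prop :=
  ∃ S : Affine.Simplex ℝ (EuclideanSpace ℝ (Fin n)) n, K = convexHull ℝ (Set.range S.points)

end

/-!
Let `g z = |K ∩ (z - L)|`, with maximum `M`. By the Brunn–Minkowski inequality
(`brunn_minkowski`, deduced from the Prékopa–Leindler inequality on the line by induction on the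
dimension) the function `(g / M) ^ (1 / n)` is concave on `K + L`. Its superlevel set at height `t`
is the convolution body with `θ = tⁿ`; a second use of Brunn–Minkowski shows that the `n`-th root
`h t` of the volume of this set is concave on `[0, 1]`. It is also antitone, and computing `∫ g` both
by Fubini and by layers gives `∫₀¹ n tⁿ⁻¹ h(t)ⁿ dt = |K| |L| / M` (`integral_levelRadius`).

The first inequality is thus about one concave function (`integral_pow_le_of_concaveOn`): for
`s ≥ 3 / 4` the integral is at most its value `(h s / (1 - s))ⁿ / (2n choose n)` for the line through
`(s, h s)` and `(1, 0)`. This is where `3 / 4` enters, through `(2n choose n) < 4ⁿ`. Moreover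
`|K| |L| / M ≥ max |K| |L|`, which dominates the mean of the two (`mean_rpow_vol_le`). The second
inequality interpolates, by concavity of `h`, between `h 0`, where it is the Brunn–Minkowski
inequality, and `h (3 / 4)`.

If equality holds, then `|K| = |L| = M`, so that `L = z - K` for some `z`, and `h` is linear. The
superlevel sets are then dilates of `K - K`, as they contain these dilates and have the same volume.
So the volume of `K ∩ (w + K)` is that of a homothet of `K` which it contains in any case, and it is
this homothet (`homotheticAtExtremePoints_of_vol_overlapLevel`). For the order on `ℝⁿ × ℝ` given by
the cone over `K` this says that, for extreme points `e ≠ e'`, the least upper bound of `(e, 1)` and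
`(e', 1)` is their sum. As in a vector lattice, where generators of distinct extreme rays are
disjoint, it follows that the extreme points are affinely independent
(`HomotheticAtExtremePoints.affineIndependent`), so `K` is a simplex by the Krein–Milman theorem.

Conversely, barycentric coordinates show that the intersections of a simplex with its translates are
homothetic to it (`vol_inter_of_affineBasis`). Hence `h` is linear, and the layer formula itself
yields the missing value `|K - K| = (2n choose n) |K|` (`vol_add_eq_choose_mul`).
-/

open MeasureTheory Set

/-! ### The Brunn–Minkowski inequality for compact sets -/

theorem volume_add_le_of_isCompact {A B : Set ℝ} (hA : IsCompact A) (hB : IsCompact B)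
    (hA' : A.Nonempty) (hB' : B.Nonempty) : volume A + volume B ≤ volume (A + B) := by
  obtain ⟨a, ha, hamax⟩ := hA.exists_isGreatest hA'
  obtain ⟨b, hb, hbmin⟩ := hB.exists_isLeast hB'
  -- translates of `A` and `B` inside `A + B` that meet in one point only
  have h1 : volume ((fun x => x + b) '' A) = volume A := by simp
  have h2 : volume ((fun x => a + x) '' B) = volume B := by simp
  have hm : MeasurableSet ((fun x => a + x) '' B) :=
    (hB.image (continuous_const.add continuous_id)).measurableSet
  have hi : volume ((fun x => x + b) '' A ∩ (fun x => a + x) '' B) = 0 := by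
    refine measure_mono_null (t := {a + b}) ?_ (by simp)
    rintro _ ⟨⟨x, hx, rfl⟩, ⟨y, hy, hxy⟩⟩
    have := hamax hx
    have := hbmin hy
    simp only [mem_singleton_iff] at *
    linarith
  rw [← h1, ← h2, ← measure_union_add_inter _ hm, hi, add_zero]
  refine measure_mono ?_
  rintro _ (⟨x, hx, rfl⟩ | ⟨x, hx, rfl⟩)
  · exact add_mem_add hx hb
  · exact add_mem_add ha hx

/-- The one-dimensional Brunn–Minkowski inequality. The set `C` stands for `A + B`, which need not
be measurable. -/
theorem volume_add_volume_le_of_add_subset {A B C : Set ℝ} (hA : MeasurableSet A)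
    (hB : MeasurableSet B) (hA' : A.Nonempty) (hB' : B.Nonempty) (h : A + B ⊆ C) :
    volume A + volume B ≤ volume C := by
  have key : ∀ K₁ ⊆ A, IsCompact K₁ → ∀ K₂ ⊆ B, IsCompact K₂ →
      volume K₁ + volume K₂ ≤ volume C := by
    intro K₁ h₁ hK₁ K₂ h₂ hK₂
    rcases K₁.eq_empty_or_nonempty with rfl | hn₁
    · obtain ⟨a, ha⟩ := hA'
      have : volume ((fun x => a + x) '' K₂) = volume K₂ := by simp
      rw [measure_empty, zero_add, ← this]
      refine measure_mono ?_
      rintro _ ⟨x, hx, rfl⟩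
      exact h (add_mem_add ha (h₂ hx))
    rcases K₂.eq_empty_or_nonempty with rfl | hn₂
    · obtain ⟨b, hb⟩ := hB'
      have : volume ((fun x => x + b) '' K₁) = volume K₁ := by simp
      rw [measure_empty, add_zero, ← this]
      refine measure_mono ?_
      rintro _ ⟨x, hx, rfl⟩
      exact h (add_mem_add (h₁ hx) hb)
    · exact (volume_add_le_of_isCompact hK₁ hK₂ hn₁ hn₂).trans
        (measure_mono ((add_subset_add h₁ h₂).trans h))
  have key₂ : ∀ K₁ ⊆ A, IsCompact K₁ → volume K₁ + volume B ≤ volume C := by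
    intro K₁ h₁ hK₁
    rcases eq_or_ne (volume C) ⊤ with hC | hC
    · simp [hC]
    have hfin : volume K₁ ≠ ⊤ := hK₁.measure_lt_top.ne
    have hle : volume K₁ ≤ volume C := by
      simpa using key K₁ h₁ hK₁ ∅ (empty_subset _) isCompact_empty
    have : volume B ≤ volume C - volume K₁ := by
      rw [hB.measure_eq_iSup_isCompact]
      refine iSup_le fun K => iSup_le fun hK => iSup_le fun hKc => ?_
      exact ENNReal.le_sub_of_add_le_left hfin (key K₁ h₁ hK₁ K hK hKc)
    calc volume K₁ + volume B ≤ volume K₁ + (volume C - volume K₁) := by gcongr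
      _ = volume C := add_tsub_cancel_of_le hle
  rcases eq_or_ne (volume C) ⊤ with hC | hC
  · simp [hC]
  have hle : volume B ≤ volume C := by
    simpa using key₂ ∅ (empty_subset _) isCompact_empty
  have : volume A ≤ volume C - volume B := by
    rw [hA.measure_eq_iSup_isCompact]
    refine iSup_le fun K => iSup_le fun hK => iSup_le fun hKc => ?_
    exact ENNReal.le_sub_of_add_le_right (ne_top_of_le_ne_top hC hle) (key₂ K hK hKc)
  calc volume A + volume B ≤ (volume C - volume B) + volume B := by gcongr
    _ = volume C := tsub_add_cancel_of_le hle

theorem volume_real_smul_add_le {A B C : Set ℝ} {r : ℝ} (hr : 0 < r) (hr1 : r < 1)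
    (hA : MeasurableSet A) (hB : MeasurableSet B) (hA' : A.Nonempty) (hB' : B.Nonempty)
    (h : ∀ x ∈ A, ∀ y ∈ B, (1 - r) * x + r * y ∈ C) :
    ENNReal.ofReal (1 - r) * volume A + ENNReal.ofReal r * volume B ≤ volume C := by
  have h1 : volume ((1 - r) • A) = ENNReal.ofReal (1 - r) * volume A := by
    rw [Measure.addHaar_smul, Module.finrank_self, pow_one, abs_of_pos (by linarith)]
  have h2 : volume (r • B) = ENNReal.ofReal r * volume B := by
    rw [Measure.addHaar_smul, Module.finrank_self, pow_one, abs_of_pos hr]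
  rw [← h1, ← h2]
  refine volume_add_volume_le_of_add_subset (hA.const_smul_of_ne_zero (by linarith))
    (hB.const_smul_of_ne_zero hr.ne') hA'.smul_set hB'.smul_set ?_
  rintro _ ⟨_, ⟨x, hx, rfl⟩, _, ⟨y, hy, rfl⟩, rfl⟩
  exact h x hx y hy

/-- The Prékopa–Leindler inequality on the line, for bounded functions. -/
theorem prekopa_leindler_real {f g h : ℝ → ℝ} {r : ℝ} (hr : 0 < r) (hr1 : r < 1)
    (hf : Measurable f) (hg : Measurable g) (hh : Measurable h)
    (hf0 : 0 ≤ f) (hg0 : 0 ≤ g) (hh0 : 0 ≤ h)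
    (hfb : BddAbove (range f)) (hgb : BddAbove (range g))
    (hfi : ∫⁻ x, ENNReal.ofReal (f x) ≠ ⊤) (hgi : ∫⁻ x, ENNReal.ofReal (g x) ≠ ⊤)
    (hhi : ∫⁻ x, ENNReal.ofReal (h x) ≠ ⊤)
    (H : ∀ x y, f x ^ (1 - r) * g y ^ r ≤ h ((1 - r) * x + r * y)) :
    (∫⁻ x, ENNReal.ofReal (f x)).toReal ^ (1 - r) * (∫⁻ x, ENNReal.ofReal (g x)).toReal ^ r ≤
      (∫⁻ x, ENNReal.ofReal (h x)).toReal := by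
  set α := ⨆ x, f x with hα
  set β := ⨆ x, g x with hβ
  have hfα : ∀ x, f x ≤ α := le_ciSup hfb
  have hgβ : ∀ x, g x ≤ β := le_ciSup hgb
  have hα0 : 0 ≤ α := (hf0 0).trans (hfα 0)
  have hβ0 : 0 ≤ β := (hg0 0).trans (hgβ 0)
  rcases hα0.eq_or_lt with hα0' | hαpos
  · have : ∀ x, ENNReal.ofReal (f x) = 0 := fun x => by
      rw [ENNReal.ofReal_eq_zero, hα0']; exact hfα x
    simp only [this, lintegral_zero, ENNReal.toReal_zero]
    rw [Real.zero_rpow (by linarith), zero_mul]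
    exact ENNReal.toReal_nonneg
  rcases hβ0.eq_or_lt with hβ0' | hβpos
  · have : ∀ x, ENNReal.ofReal (g x) = 0 := fun x => by
      rw [ENNReal.ofReal_eq_zero, hβ0']; exact hgβ x
    simp only [this, lintegral_zero, ENNReal.toReal_zero]
    rw [Real.zero_rpow hr.ne', mul_zero]
    exact ENNReal.toReal_nonneg
  set γ := α ^ (1 - r) * β ^ r with hγ
  have hγpos : 0 < γ := by positivity
  have scale : ∀ {u : ℝ → ℝ} {c : ℝ}, 0 < c → Measurable u → 0 ≤ u →
      (∫⁻ t in Ioi (0 : ℝ), volume {x | t < u x / c}) =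
        ENNReal.ofReal c⁻¹ * ∫⁻ x, ENNReal.ofReal (u x) := by
    intro u c hc hu hu0
    rw [← lintegral_const_mul _ hu.ennreal_ofReal, ← lintegral_eq_lintegral_meas_lt]
    · refine lintegral_congr fun x => ?_
      rw [← ENNReal.ofReal_mul (by positivity), div_eq_inv_mul]
    · exact Filter.Eventually.of_forall fun x => div_nonneg (hu0 x) hc.le
    · exact (hu.div_const c).aemeasurable
  have level : ∀ t ∈ Ioi (0 : ℝ),
      ENNReal.ofReal (1 - r) * volume {x | t < f x / α} +
        ENNReal.ofReal r * volume {x | t < g x / β} ≤ volume {x | t < h x / γ} := by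
    intro t ht
    rw [mem_Ioi] at ht
    rcases le_or_gt 1 t with h1 | h1
    · have e1 : {x | t < f x / α} = ∅ := by
        refine eq_empty_of_forall_notMem fun x hx => ?_
        have : f x / α ≤ 1 := (div_le_one hαpos).2 (hfα x)
        exact absurd (hx.trans_le this) (not_lt.2 h1)
      have e2 : {x | t < g x / β} = ∅ := by
        refine eq_empty_of_forall_notMem fun x hx => ?_
        have : g x / β ≤ 1 := (div_le_one hβpos).2 (hgβ x)
        exact absurd (hx.trans_le this) (not_lt.2 h1)
      simp [e1, e2]
    · refine volume_real_smul_add_le hr hr1 (measurableSet_lt measurable_const (hf.div_const _))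
        (measurableSet_lt measurable_const (hg.div_const _)) ?_ ?_ ?_
      · obtain ⟨x, hx⟩ := exists_lt_of_lt_ciSup (show t * α < ⨆ x, f x by
          rw [← hα]; nlinarith)
        exact ⟨x, (lt_div_iff₀ hαpos).2 hx⟩
      · obtain ⟨x, hx⟩ := exists_lt_of_lt_ciSup (show t * β < ⨆ x, g x by
          rw [← hβ]; nlinarith)
        exact ⟨x, (lt_div_iff₀ hβpos).2 hx⟩
      · intro x hx y hy
        have hx' : t * α < f x := (lt_div_iff₀ hαpos).1 hx
        have hy' : t * β < g y := (lt_div_iff₀ hβpos).1 hy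
        show t < _ / γ
        rw [lt_div_iff₀ hγpos]
        refine lt_of_lt_of_le ?_ (H x y)
        have e : t * γ = (t * α) ^ (1 - r) * (t * β) ^ r := by
          rw [Real.mul_rpow ht.le hαpos.le, Real.mul_rpow ht.le hβpos.le, hγ]
          have : t ^ (1 - r) * t ^ r = t := by
            rw [← Real.rpow_add ht]; simp
          calc t * (α ^ (1 - r) * β ^ r) = (t ^ (1 - r) * t ^ r) * (α ^ (1 - r) * β ^ r) := by
                rw [this]
            _ = _ := by ring
        rw [e]
        have i1 : (t * α) ^ (1 - r) < f x ^ (1 - r) :=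
          Real.rpow_lt_rpow (by positivity) hx' (by linarith)
        have i2 : (t * β) ^ r < g y ^ r := Real.rpow_lt_rpow (by positivity) hy' hr
        exact mul_lt_mul'' i1 i2 (by positivity) (by positivity)
  have sum : ENNReal.ofReal (1 - r) * (ENNReal.ofReal α⁻¹ * ∫⁻ x, ENNReal.ofReal (f x)) +
      ENNReal.ofReal r * (ENNReal.ofReal β⁻¹ * ∫⁻ x, ENNReal.ofReal (g x)) ≤
      ENNReal.ofReal γ⁻¹ * ∫⁻ x, ENNReal.ofReal (h x) := by
    rw [← scale hαpos hf hf0, ← scale hβpos hg hg0, ← scale hγpos hh hh0]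
    have anti : ∀ u : ℝ → ℝ, Measurable fun t : ℝ => volume {x | t < u x} := fun u =>
      Antitone.measurable fun s t hst => measure_mono fun x (hx : t < u x) => hst.trans_lt hx
    rw [← lintegral_const_mul _ (anti _), ← lintegral_const_mul _ (anti _),
      ← lintegral_add_left ((anti _).const_mul _)]
    exact setLIntegral_mono (anti _) level
  have sum' := (ENNReal.toReal_le_toReal (by finiteness) (by finiteness)).2 sum
  rw [ENNReal.toReal_add (by finiteness) (by finiteness)] at sum'
  simp only [ENNReal.toReal_mul] at sum'
  rw [ENNReal.toReal_ofReal (by linarith), ENNReal.toReal_ofReal (by positivity),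
    ENNReal.toReal_ofReal (by positivity), ENNReal.toReal_ofReal (by positivity),
    ENNReal.toReal_ofReal (by positivity)] at sum'
  set F := (∫⁻ x, ENNReal.ofReal (f x)).toReal
  set G := (∫⁻ x, ENNReal.ofReal (g x)).toReal
  have hF : 0 ≤ F := ENNReal.toReal_nonneg
  have hG : 0 ≤ G := ENNReal.toReal_nonneg
  have amgm := Real.geom_mean_le_arith_mean2_weighted (w₁ := 1 - r) (w₂ := r) (by linarith) hr.le
    (show 0 ≤ α⁻¹ * F by positivity) (show 0 ≤ β⁻¹ * G by positivity) (by ring)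
  have := amgm.trans sum'
  rw [Real.mul_rpow (by positivity) hF, Real.mul_rpow (by positivity) hG,
    Real.inv_rpow hαpos.le, Real.inv_rpow hβpos.le, inv_mul_eq_div, inv_mul_eq_div,
    inv_mul_eq_div, div_mul_div_comm, ← hγ] at this
  exact (div_le_div_iff_of_pos_right hγpos).1 this

/-- The slice at first coordinate `t` of a set in `ℝⁿ⁺¹`. -/
def firstSlice {n : ℕ} (A : Set (Fin (n + 1) → ℝ)) (t : ℝ) : Set (Fin n → ℝ) :=
  {y | (Fin.cons t y : Fin (n + 1) → ℝ) ∈ A}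

theorem IsCompact.firstSlice {n : ℕ} {A : Set (Fin (n + 1) → ℝ)} (hA : IsCompact A) (t : ℝ) :
    IsCompact (firstSlice A t) := by
  have hc : Continuous fun y : Fin n → ℝ => (Fin.cons t y : Fin (n + 1) → ℝ) := by fun_prop
  refine (hA.image (f := fun x : Fin (n + 1) → ℝ => Fin.tail x) (by
    unfold Fin.tail; fun_prop)).of_isClosed_subset (hA.isClosed.preimage hc) ?_
  exact fun y hy => ⟨_, hy, Fin.tail_cons _ _⟩

theorem volume_firstSlice_le {n : ℕ} (A : Set (Fin (n + 1) → ℝ)) (t : ℝ) :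
    volume (firstSlice A t) ≤ volume ((fun x : Fin (n + 1) → ℝ => Fin.tail x) '' A) :=
  measure_mono fun _ hy => ⟨_, hy, Fin.tail_cons _ _⟩

theorem measurable_volume_firstSlice {n : ℕ} {A : Set (Fin (n + 1) → ℝ)} (hA : MeasurableSet A) :
    Measurable (fun t => volume (firstSlice A t)) ∧
      ∫⁻ t, volume (firstSlice A t) = volume A := by
  let e := (MeasurableEquiv.piFinSuccAbove (fun _ : Fin (n + 1) => ℝ) 0).symm
  have hs : ∀ t, firstSlice A t = Prod.mk t ⁻¹' (e ⁻¹' A) := by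
    intro t
    ext y
    simp [firstSlice, e, MeasurableEquiv.piFinSuccAbove, Fin.insertNthEquiv]
  have hm : MeasurableSet (e ⁻¹' A) := e.measurable hA
  have hp : MeasurePreserving e volume volume :=
    (volume_preserving_piFinSuccAbove (fun _ : Fin (n + 1) => ℝ) 0).symm
  simp only [hs]
  refine ⟨measurable_measure_prodMk_left hm, ?_⟩
  rw [← hp.measure_preimage hA.nullMeasurableSet]
  exact (Measure.prod_apply hm).symm

/-- The multiplicative Brunn–Minkowski inequality in `ℝⁿ`, by induction on `n`: the slices satisfy
the hypothesis of the one-dimensional Prékopa–Leindler inequality. -/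
theorem volume_pi_rpow_mul_rpow_le {r : ℝ} (hr : 0 < r) (hr1 : r < 1) : ∀ (n : ℕ)
    (A B C : Set (Fin n → ℝ)), IsCompact A → IsCompact B → IsCompact C →
    (∀ x ∈ A, ∀ y ∈ B, (1 - r) • x + r • y ∈ C) →
    (volume A).toReal ^ (1 - r) * (volume B).toReal ^ r ≤ (volume C).toReal := by
  intro n
  induction n with
  | zero =>
    intro A B C hA hB hC H
    rcases A.eq_empty_or_nonempty with rfl | ⟨a, ha⟩
    · rw [measure_empty, ENNReal.toReal_zero, Real.zero_rpow (by linarith), zero_mul]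
      exact ENNReal.toReal_nonneg
    rcases B.eq_empty_or_nonempty with rfl | ⟨b, hb⟩
    · rw [measure_empty, ENNReal.toReal_zero, Real.zero_rpow hr.ne', mul_zero]
      exact ENNReal.toReal_nonneg
    have hu : ∀ (S : Set (Fin 0 → ℝ)) (x : Fin 0 → ℝ), x ∈ S → S = univ := fun S x hx =>
      eq_univ_of_forall fun y => Subsingleton.elim x y ▸ hx
    rw [hu A a ha, hu B b hb, hu C _ (H a ha b hb)]
    simp [volume_pi]
  | succ n ih =>
    intro A B C hA hB hC H
    have bdd : ∀ S : Set (Fin (n + 1) → ℝ), IsCompact S →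
        volume ((fun x : Fin (n + 1) → ℝ => Fin.tail x) '' S) < ⊤ := fun S hS =>
      (hS.image (by unfold Fin.tail; fun_prop)).measure_lt_top
    have lt_top : ∀ S : Set (Fin (n + 1) → ℝ), IsCompact S → ∀ t,
        volume (firstSlice S t) < ⊤ := fun S hS t => (hS.firstSlice t).measure_lt_top
    have int_eq : ∀ S : Set (Fin (n + 1) → ℝ), IsCompact S →
        ∫⁻ t, ENNReal.ofReal (volume (firstSlice S t)).toReal = volume S := by
      intro S hS
      rw [← (measurable_volume_firstSlice hS.measurableSet).2]
      exact lintegral_congr fun t => ENNReal.ofReal_toReal (lt_top S hS t).ne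
    have bound : ∀ S : Set (Fin (n + 1) → ℝ), IsCompact S →
        BddAbove (range fun t => (volume (firstSlice S t)).toReal) := by
      rintro S hS
      refine ⟨(volume ((fun x : Fin (n + 1) → ℝ => Fin.tail x) '' S)).toReal, ?_⟩
      rintro _ ⟨t, rfl⟩
      exact ENNReal.toReal_mono (bdd S hS).ne (volume_firstSlice_le S t)
    have key := prekopa_leindler_real (f := fun t => (volume (firstSlice A t)).toReal)
      (g := fun t => (volume (firstSlice B t)).toReal)
      (h := fun t => (volume (firstSlice C t)).toReal) hr hr1
      (measurable_volume_firstSlice hA.measurableSet).1.ennreal_toReal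
      (measurable_volume_firstSlice hB.measurableSet).1.ennreal_toReal
      (measurable_volume_firstSlice hC.measurableSet).1.ennreal_toReal
      (fun _ => ENNReal.toReal_nonneg) (fun _ => ENNReal.toReal_nonneg)
      (fun _ => ENNReal.toReal_nonneg) (bound A hA) (bound B hB)
      (by rw [int_eq A hA]; exact hA.measure_lt_top.ne)
      (by rw [int_eq B hB]; exact hB.measure_lt_top.ne)
      (by rw [int_eq C hC]; exact hC.measure_lt_top.ne)
      (by
        intro s t
        refine ih _ _ _ (hA.firstSlice s) (hB.firstSlice t) (hC.firstSlice _) ?_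
        intro x hx y hy
        have := H _ hx _ hy
        change (Fin.cons _ _ : Fin (n + 1) → ℝ) ∈ C
        convert this using 1
        ext i
        refine Fin.cases ?_ (fun j => ?_) i <;> simp)
    rwa [int_eq A hA, int_eq B hB, int_eq C hC] at key

theorem vol_nonneg {n : ℕ} (A : Set (EuclideanSpace ℝ (Fin n))) : 0 ≤ vol A :=
  ENNReal.toReal_nonneg

theorem vol_mono {n : ℕ} {A B : Set (EuclideanSpace ℝ (Fin n))} (hB : IsCompact B) (h : A ⊆ B) :
    vol A ≤ vol B :=
  ENNReal.toReal_mono hB.measure_lt_top.ne (measure_mono h)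

theorem vol_smul {n : ℕ} {r : ℝ} (hr : 0 ≤ r) (A : Set (EuclideanSpace ℝ (Fin n))) :
    vol (r • A) = r ^ n * vol A := by
  rw [vol, Measure.addHaar_smul, finrank_euclideanSpace_fin, abs_of_nonneg (by positivity),
    ENNReal.toReal_mul, ENNReal.toReal_ofReal (by positivity), vol]

theorem vol_smul_rpow {n : ℕ} (hn : 1 ≤ n) {r : ℝ} (hr : 0 ≤ r)
    (A : Set (EuclideanSpace ℝ (Fin n))) :
    vol (r • A) ^ (1 / (n : ℝ)) = r * vol A ^ (1 / (n : ℝ)) := by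
  rw [vol_smul hr, Real.mul_rpow (by positivity) (vol_nonneg A), one_div,
    Real.pow_rpow_inv_natCast hr (by omega)]

theorem vol_vadd {n : ℕ} (x : EuclideanSpace ℝ (Fin n)) (A : Set (EuclideanSpace ℝ (Fin n))) :
    vol (x +ᵥ A) = vol A := by
  rw [vol, measure_vadd, vol]

theorem vol_neg {n : ℕ} (A : Set (EuclideanSpace ℝ (Fin n))) : vol (-A) = vol A := by
  rw [vol, Measure.measure_neg, vol]

theorem vol_rpow_mul_rpow_le {n : ℕ} {r : ℝ} (hr : 0 < r) (hr1 : r < 1)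
    {A B : Set (EuclideanSpace ℝ (Fin n))} (hA : IsCompact A) (hB : IsCompact B) :
    vol A ^ (1 - r) * vol B ^ r ≤ vol ((1 - r) • A + r • B) := by
  have hS : ∀ S : Set (EuclideanSpace ℝ (Fin n)), IsCompact S →
      IsCompact ((WithLp.toLp 2 : (Fin n → ℝ) → EuclideanSpace ℝ (Fin n)) ⁻¹' S) ∧
      vol S = (volume ((WithLp.toLp 2 : (Fin n → ℝ) → EuclideanSpace ℝ (Fin n)) ⁻¹' S)).toReal := by
    intro S hS
    have himg : (WithLp.toLp 2 : (Fin n → ℝ) → EuclideanSpace ℝ (Fin n)) ⁻¹' S =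
        (WithLp.ofLp : EuclideanSpace ℝ (Fin n) → (Fin n → ℝ)) '' S := by
      ext x
      constructor
      · intro hx; exact ⟨_, hx, rfl⟩
      · rintro ⟨y, hy, rfl⟩; exact hy
    refine ⟨?_, ?_⟩
    · rw [himg]
      exact hS.image (PiLp.continuous_ofLp 2 _)
    · rw [vol, (PiLp.volume_preserving_toLp (Fin n)).measure_preimage
        hS.measurableSet.nullMeasurableSet]
  have hC : IsCompact ((1 - r) • A + r • B) := (hA.smul _).add (hB.smul _)
  rw [(hS A hA).2, (hS B hB).2, (hS _ hC).2]
  refine volume_pi_rpow_mul_rpow_le hr hr1 n _ _ _ (hS A hA).1 (hS B hB).1 (hS _ hC).1 ?_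
  intro x hx y hy
  exact add_mem_add (smul_mem_smul_set hx) (smul_mem_smul_set hy)

/-- The **Brunn–Minkowski inequality** for compact sets. -/
theorem brunn_minkowski {n : ℕ} (hn : 1 ≤ n) {A B : Set (EuclideanSpace ℝ (Fin n))}
    (hA : IsCompact A) (hB : IsCompact B) (hA' : A.Nonempty) (hB' : B.Nonempty) :
    vol A ^ (1 / (n : ℝ)) + vol B ^ (1 / (n : ℝ)) ≤ vol (A + B) ^ (1 / (n : ℝ)) := by
  have hn' : (0 : ℝ) < 1 / n := by positivity
  have hAB : IsCompact (A + B) := hA.add hB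
  rcases (vol_nonneg A).eq_or_lt with h0 | hApos
  · obtain ⟨a, ha⟩ := hA'
    rw [← h0, Real.zero_rpow hn'.ne', zero_add, ← vol_vadd a B]
    refine Real.rpow_le_rpow (vol_nonneg _) (vol_mono hAB ?_) hn'.le
    rintro _ ⟨b, hb, rfl⟩
    exact add_mem_add ha hb
  rcases (vol_nonneg B).eq_or_lt with h0 | hBpos
  · obtain ⟨b, hb⟩ := hB'
    rw [← h0, Real.zero_rpow hn'.ne', add_zero, ← vol_vadd b A]
    refine Real.rpow_le_rpow (vol_nonneg _) (vol_mono hAB ?_) hn'.le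
    rintro _ ⟨a, ha, rfl⟩
    exact ⟨a, ha, b, hb, add_comm _ _⟩
  set a := vol A ^ (1 / (n : ℝ)) with ha
  set b := vol B ^ (1 / (n : ℝ)) with hb
  have hap : 0 < a := by positivity
  have hbp : 0 < b := by positivity
  -- apply the multiplicative inequality to the dilates of volume one
  have h1 : vol (a⁻¹ • A) = 1 := by
    rw [vol_smul (by positivity), inv_pow, ha, one_div, Real.rpow_inv_natCast_pow hApos.le (by omega)]
    exact inv_mul_cancel₀ hApos.ne'
  have h2 : vol (b⁻¹ • B) = 1 := by
    rw [vol_smul (by positivity), inv_pow, hb, one_div, Real.rpow_inv_natCast_pow hBpos.le (by omega)]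
    exact inv_mul_cancel₀ hBpos.ne'
  have key := vol_rpow_mul_rpow_le (r := b / (a + b)) (by positivity)
    ((div_lt_one (by positivity)).2 (by linarith)) (hA.smul a⁻¹) (hB.smul b⁻¹)
  rw [h1, h2, Real.one_rpow, Real.one_rpow, one_mul, smul_smul, smul_smul] at key
  have e1 : (1 - b / (a + b)) * a⁻¹ = (a + b)⁻¹ := by field_simp; ring
  have e2 : b / (a + b) * b⁻¹ = (a + b)⁻¹ := by field_simp
  rw [e1, e2, ← smul_add] at key
  have := Real.rpow_le_rpow zero_le_one key hn'.le
  rw [Real.one_rpow, vol_smul_rpow hn (by positivity), inv_mul_eq_div,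
    one_le_div (by positivity)] at this
  exact this

/-! ### A one-dimensional inequality for concave functions -/

theorem integral_pow_mul_one_sub_pow (a b : ℕ) :
    ∫ t in (0 : ℝ)..1, t ^ a * (1 - t) ^ b =
      (a.factorial * b.factorial : ℝ) / ((a + b + 1).factorial : ℝ) := by
  induction b generalizing a with
  | zero =>
    simp only [pow_zero, mul_one, integral_pow, add_zero, Nat.factorial_succ]
    have : (a.factorial : ℝ) ≠ 0 := by positivity
    push_cast
    field_simp
    simp
  | succ b ih =>
    -- integrate the derivative of `t ^ (a + 1) * (1 - t) ^ (b + 1)`, which vanishes at both ends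
    have hd : ∀ t : ℝ, HasDerivAt (fun t : ℝ => t ^ (a + 1) * (1 - t) ^ (b + 1))
        ((a + 1) * (t ^ a * (1 - t) ^ (b + 1)) - (b + 1) * (t ^ (a + 1) * (1 - t) ^ b)) t := by
      intro t
      have h1 := (hasDerivAt_id t).pow (a + 1)
      have h2 := ((hasDerivAt_id t).const_sub 1).pow (b + 1)
      have h3 := h1.mul h2
      convert! h3 using 1
      simp
      ring
    have h := intervalIntegral.integral_eq_sub_of_hasDerivAt (a := 0) (b := 1)
      (fun t _ => hd t) (by apply Continuous.intervalIntegrable; fun_prop)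
    rw [intervalIntegral.integral_sub (by apply Continuous.intervalIntegrable; fun_prop)
      (by apply Continuous.intervalIntegrable; fun_prop), intervalIntegral.integral_const_mul,
      intervalIntegral.integral_const_mul, ih (a + 1)] at h
    simp only [one_pow, sub_self, zero_pow (Nat.succ_ne_zero b), mul_zero,
      zero_pow (Nat.succ_ne_zero a), zero_mul] at h
    have e : a + 1 + b + 1 = a + (b + 1) + 1 := by ring
    rw [e, Nat.factorial_succ a] at h
    rw [Nat.factorial_succ b]
    have : ((a + (b + 1) + 1).factorial : ℝ) ≠ 0 := by positivity
    have ha : (a + 1 : ℝ) ≠ 0 := by positivity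
    push_cast at h ⊢
    apply mul_left_cancel₀ ha
    rw [sub_eq_zero.1 h]
    ring

theorem integral_beta_choose {n : ℕ} (hn : 1 ≤ n) :
    ∫ t in (0 : ℝ)..1, n * t ^ (n - 1) * (1 - t) ^ n = 1 / ((2 * n).choose n : ℝ) := by
  simp only [mul_assoc]
  rw [intervalIntegral.integral_const_mul, integral_pow_mul_one_sub_pow]
  have e : n - 1 + n + 1 = 2 * n := by omega
  have hc : (2 * n).choose n * n.factorial * n.factorial = (2 * n).factorial := by
    have := Nat.choose_mul_factorial_mul_factorial (n := 2 * n) (k := n) (by omega)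
    rwa [show 2 * n - n = n by omega] at this
  have hf : n * (n - 1).factorial = n.factorial := Nat.mul_factorial_pred (by omega)
  have hC : ((2 * n).choose n : ℝ) ≠ 0 := by
    exact_mod_cast (Nat.choose_pos (by omega)).ne'
  rw [e, ← hc, ← mul_div_assoc, ← mul_assoc]
  have hf' : (n : ℝ) * (n - 1).factorial = n.factorial := by exact_mod_cast hf
  rw [hf']
  push_cast
  have : (n.factorial : ℝ) ≠ 0 := by positivity
  field_simp

theorem choose_two_mul_self_lt_four_pow {n : ℕ} (hn : 1 ≤ n) : (2 * n).choose n < 4 ^ n := by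
  have h := Nat.sum_range_choose (2 * n)
  rw [pow_mul] at h
  norm_num at h
  rw [← h]
  exact Finset.single_lt_sum (i := n) (j := 0) (by omega) (by simp; omega) (by simp)
    (by simp) (fun _ _ _ => Nat.zero_le _)

theorem ConcaveOn.exists_support {h : ℝ → ℝ} (hc : ConcaveOn ℝ (Icc 0 1) h)
    (ha : AntitoneOn h (Icc 0 1)) (h0 : ∀ t ∈ Icc (0 : ℝ) 1, 0 ≤ h t) {s : ℝ} (hs0 : 0 < s)
    (hs1 : s < 1) :
    ∃ μ ∈ Icc (0 : ℝ) 1, ∀ t ∈ Icc (0 : ℝ) 1,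
      h t ≤ h s / (1 - s) * ((1 - μ) * (1 - s) + μ * (1 - t)) := by
  have hsm : s ∈ Icc (0 : ℝ) 1 := ⟨hs0.le, hs1.le⟩
  have h1m : (1 : ℝ) ∈ Icc (0 : ℝ) 1 := by simp
  have hs1' : 0 < 1 - s := by linarith
  set S := (fun t => (h t - h s) / (s - t)) '' Ico 0 s with hS
  have hne : S.Nonempty := ⟨_, 0, ⟨le_rfl, hs0⟩, rfl⟩
  have hle : ∀ m ∈ S, ∀ t, s < t → t ≤ 1 → m ≤ (h s - h t) / (t - s) := by
    rintro _ ⟨u, ⟨hu0, hus⟩, rfl⟩ t hst ht1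
    have := hc.slope_anti_adjacent (x := u) (y := s) (z := t) ⟨hu0, by linarith⟩
      ⟨by linarith, ht1⟩ hus hst
    have e1 : (h u - h s) / (s - u) = -((h s - h u) / (s - u)) := by ring
    have e2 : (h s - h t) / (t - s) = -((h t - h s) / (t - s)) := by ring
    show (h u - h s) / (s - u) ≤ _
    rw [e1, e2]
    linarith
  have hbdd : BddAbove S := ⟨_, fun m hm => hle m hm 1 hs1 le_rfl⟩
  set m := sSup S with hm
  have hm0 : 0 ≤ m := by
    refine le_trans ?_ (le_csSup hbdd ⟨0, ⟨le_rfl, hs0⟩, rfl⟩)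
    exact div_nonneg (sub_nonneg.2 (ha (by simp) hsm hs0.le)) (by linarith)
  have hmc : m ≤ h s / (1 - s) := by
    refine csSup_le hne fun x hx => (hle x hx 1 hs1 le_rfl).trans ?_
    exact div_le_div_of_nonneg_right (by linarith [h0 1 h1m]) hs1'.le
  have hline : ∀ t ∈ Icc (0 : ℝ) 1, h t ≤ h s + m * (s - t) := by
    rintro t ⟨ht0, ht1⟩
    rcases lt_trichotomy t s with hts | rfl | hts
    · have := le_csSup hbdd ⟨t, ⟨ht0, hts⟩, rfl⟩
      have := (div_le_iff₀ (by linarith)).1 this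
      linarith
    · simp
    · have := csSup_le hne fun x hx => hle x hx t hts ht1
      have := (le_div_iff₀ (by linarith)).1 this
      linarith
  rcases (div_nonneg (h0 s hsm) hs1'.le).eq_or_lt with hc0 | hcpos
  · refine ⟨0, by simp, fun t ht => ?_⟩
    have hm0' : m = 0 := le_antisymm (hmc.trans hc0.ge) hm0
    have := hline t ht
    rw [hm0', zero_mul, add_zero] at this
    rw [sub_zero, one_mul, zero_mul, add_zero, div_mul_cancel₀ _ hs1'.ne']
    exact this
  · refine ⟨m / (h s / (1 - s)), ⟨by positivity, (div_le_one hcpos).2 hmc⟩, fun t ht => ?_⟩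
    refine (hline t ht).trans_eq ?_
    have hne' : h s ≠ 0 := fun h => by simp [h] at hcpos
    field_simp
    ring

theorem AntitoneOn.intervalIntegrable_pow {h : ℝ → ℝ} (ha : AntitoneOn h (Icc 0 1))
    (h0 : ∀ t ∈ Icc (0 : ℝ) 1, 0 ≤ h t) (n : ℕ) :
    IntervalIntegrable (fun t => n * t ^ (n - 1) * h t ^ n) volume 0 1 := by
  have h1 : AntitoneOn (fun t => h t ^ n) (uIcc (0 : ℝ) 1) := by
    rw [uIcc_of_le zero_le_one]
    exact fun x hx y hy hxy => pow_le_pow_left₀ (h0 y hy) (ha hx hy hxy) n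
  exact (h1.intervalIntegrable (μ := volume)).continuousOn_mul (by fun_prop)

/-- The integral of `n t ^ (n - 1) h(t) ^ n` for a concave, antitone `h ≥ 0` is at most its value
for the line through `(s, h s)` and `(1, 0)`, if `s` is at least `3 / 4`, with equality only for
that line. By concavity it suffices to treat the support line of `h` at `s`, whose slope lies
between those of the constant `h s` and of the line; the `n`-th power being convex, the two extreme
slopes are the worst, and the constant is harmless as `(1 - s) ^ n ≤ 4 ^ (-n) < 1 / (2n choose n)`. -/
theorem integral_pow_le_of_concaveOn {n : ℕ} (hn : 1 ≤ n) {h : ℝ → ℝ}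
    (hc : ConcaveOn ℝ (Icc 0 1) h) (ha : AntitoneOn h (Icc 0 1))
    (h0 : ∀ t ∈ Icc (0 : ℝ) 1, 0 ≤ h t) {s : ℝ} (hs : 3 / 4 ≤ s) (hs1 : s < 1) :
    ∫ t in (0 : ℝ)..1, n * t ^ (n - 1) * h t ^ n ≤
      (h s / (1 - s)) ^ n * (1 / ((2 * n).choose n : ℝ)) ∧
    (0 < h s → ∫ t in (0 : ℝ)..1, n * t ^ (n - 1) * h t ^ n =
      (h s / (1 - s)) ^ n * (1 / ((2 * n).choose n : ℝ)) →
      ∀ t ∈ Icc (0 : ℝ) 1, h t = h s / (1 - s) * (1 - t)) := by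
  have hs1' : 0 < 1 - s := by linarith
  obtain ⟨μ, ⟨hμ0, hμ1⟩, hμ⟩ := hc.exists_support ha h0 (by linarith : 0 < s) hs1
  set c := h s / (1 - s) with hcdef
  set C : ℝ := ((2 * n).choose n : ℝ) with hC
  have hc0 : 0 ≤ c := div_nonneg (h0 s ⟨by linarith, hs1.le⟩) hs1'.le
  have hCpos : 0 < C := by
    rw [hC]; exact_mod_cast Nat.choose_pos (by omega)
  have hC4 : (1 - s) ^ n < 1 / C := by
    have h1 : (1 - s) ^ n ≤ (1 / 4 : ℝ) ^ n := pow_le_pow_left₀ hs1'.le (by linarith) n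
    refine h1.trans_lt ?_
    rw [one_div_pow]
    refine one_div_lt_one_div_of_lt hCpos ?_
    rw [hC]; exact_mod_cast choose_two_mul_self_lt_four_pow hn
  have hint := ha.intervalIntegrable_pow h0 n
  have hint2 : IntervalIntegrable
      (fun t : ℝ => c ^ n * ((1 - μ) * (1 - s) ^ n * (n * t ^ (n - 1)) +
        μ * (n * t ^ (n - 1) * (1 - t) ^ n))) volume 0 1 := by
    apply Continuous.intervalIntegrable; fun_prop
  have hI2 : ∫ t in (0 : ℝ)..1, c ^ n * ((1 - μ) * (1 - s) ^ n * (n * t ^ (n - 1)) +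
        μ * (n * t ^ (n - 1) * (1 - t) ^ n)) = c ^ n * ((1 - μ) * (1 - s) ^ n + μ * (1 / C)) := by
    rw [intervalIntegral.integral_const_mul, intervalIntegral.integral_add
      (by apply Continuous.intervalIntegrable; fun_prop)
      (by apply Continuous.intervalIntegrable; fun_prop), intervalIntegral.integral_const_mul μ,
      integral_beta_choose hn, intervalIntegral.integral_const_mul,
      intervalIntegral.integral_const_mul, integral_pow]
    have e : n - 1 + 1 = n := by omega
    have e' : ((n - 1 : ℕ) : ℝ) + 1 = n := by exact_mod_cast e
    have hn0 : (n : ℝ) ≠ 0 := by positivity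
    rw [e, e', one_pow, zero_pow (by omega), sub_zero, mul_one_div, div_self hn0, mul_one]
  have hle : ∀ t ∈ Icc (0 : ℝ) 1, n * t ^ (n - 1) * h t ^ n ≤
      c ^ n * ((1 - μ) * (1 - s) ^ n * (n * t ^ (n - 1)) +
        μ * (n * t ^ (n - 1) * (1 - t) ^ n)) := by
    intro t ht
    have h1 : h t ^ n ≤ (c * ((1 - μ) * (1 - s) + μ * (1 - t))) ^ n :=
      pow_le_pow_left₀ (h0 t ht) (hμ t ht) n
    have h2 := (convexOn_pow n).2 (show 1 - s ∈ Ici (0 : ℝ) from hs1'.le)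
      (show 1 - t ∈ Ici (0 : ℝ) from by simpa using ht.2) (show 0 ≤ 1 - μ by linarith) hμ0
      (by ring)
    simp only [smul_eq_mul] at h2
    have h3 : h t ^ n ≤ c ^ n * ((1 - μ) * (1 - s) ^ n + μ * (1 - t) ^ n) := by
      rw [mul_pow] at h1
      exact h1.trans (mul_le_mul_of_nonneg_left h2 (by positivity))
    have h4 : 0 ≤ (n : ℝ) * t ^ (n - 1) := by have := ht.1; positivity
    calc _ ≤ n * t ^ (n - 1) * (c ^ n * ((1 - μ) * (1 - s) ^ n + μ * (1 - t) ^ n)) :=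
          mul_le_mul_of_nonneg_left h3 h4
      _ = _ := by ring
  have hI := intervalIntegral.integral_mono_on zero_le_one hint hint2 hle
  rw [hI2] at hI
  refine ⟨hI.trans ?_, fun hpos heq => ?_⟩
  · refine mul_le_mul_of_nonneg_left ?_ (by positivity)
    nlinarith
  · have hcpos : 0 < c ^ n := pow_pos (div_pos hpos hs1') n
    have hμ1' : μ = 1 := by
      rw [heq] at hI
      have := le_of_mul_le_mul_left hI hcpos
      nlinarith
    rw [hμ1'] at hμ
    simp only [sub_self, zero_mul, one_mul, zero_add] at hμ
    by_contra! hcon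
    obtain ⟨u, ⟨hu0, hu1⟩, hne⟩ := hcon
    have hlt : h u < c * (1 - u) := lt_of_le_of_ne (hμ u ⟨hu0, hu1⟩) hne
    have hcpos' : 0 < c := div_pos hpos hs1'
    have hhu := h0 u ⟨hu0, hu1⟩
    -- by monotonicity `h` stays below the line on the whole interval `(u, v)`
    set v := 1 - h u / c with hv
    have huv : u < v := by
      have : h u / c < 1 - u := by rw [div_lt_iff₀ hcpos']; linarith
      linarith
    have hv1 : v ≤ 1 := by
      have : 0 ≤ h u / c := by positivity
      linarith
    have hintc : IntervalIntegrable (fun t : ℝ => c ^ n * (n * t ^ (n - 1) * (1 - t) ^ n))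
        volume 0 1 := by apply Continuous.intervalIntegrable; fun_prop
    have hintd := hintc.sub hint
    have hzero : ∫ t in (0 : ℝ)..1, (c ^ n * (n * t ^ (n - 1) * (1 - t) ^ n) -
        n * t ^ (n - 1) * h t ^ n) = 0 := by
      rw [intervalIntegral.integral_sub hintc hint, heq, intervalIntegral.integral_const_mul,
        integral_beta_choose hn, sub_self]
    have hnn : ∀ t ∈ Icc (0 : ℝ) 1, 0 ≤ c ^ n * (n * t ^ (n - 1) * (1 - t) ^ n) -
        n * t ^ (n - 1) * h t ^ n := by
      intro t ht
      have h1 : h t ^ n ≤ (c * (1 - t)) ^ n := pow_le_pow_left₀ (h0 t ht) (hμ t ht) n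
      have h4 : 0 ≤ (n : ℝ) * t ^ (n - 1) := by have := ht.1; positivity
      have := mul_le_mul_of_nonneg_left h1 h4
      rw [mul_pow] at this
      linarith
    have hsub : uIcc u v ⊆ uIcc (0 : ℝ) 1 := by
      rw [uIcc_of_le huv.le, uIcc_of_le zero_le_one]
      exact Icc_subset_Icc hu0 hv1
    have hpos2 : 0 < ∫ t in u..v, (c ^ n * (n * t ^ (n - 1) * (1 - t) ^ n) -
        n * t ^ (n - 1) * h t ^ n) := by
      refine intervalIntegral.intervalIntegral_pos_of_pos_on (hintd.mono_set hsub) ?_ huv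
      rintro t ⟨hut, htv⟩
      have ht0 : 0 < t := hu0.trans_lt hut
      have htm : t ∈ Icc (0 : ℝ) 1 := ⟨ht0.le, by linarith⟩
      have h1 : h t ≤ h u := ha ⟨hu0, hu1⟩ htm hut.le
      have h2 : h u < c * (1 - t) := by
        have : h u / c < 1 - t := by linarith
        rw [div_lt_iff₀ hcpos'] at this
        linarith
      have h3 : h t ^ n < (c * (1 - t)) ^ n :=
        pow_lt_pow_left₀ (h1.trans_lt h2) (h0 t htm) (by omega)
      have h4 : 0 < (n : ℝ) * t ^ (n - 1) := by positivity
      have := mul_lt_mul_of_pos_left h3 h4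
      rw [mul_pow] at this
      linarith
    have hmono := intervalIntegral.integral_mono_interval hu0 huv.le hv1 (μ := volume)
      (f := fun t => c ^ n * (n * t ^ (n - 1) * (1 - t) ^ n) - n * t ^ (n - 1) * h t ^ n)
      (by
        refine (ae_restrict_iff' measurableSet_Ioc).2 (Filter.Eventually.of_forall fun t ht => ?_)
        exact hnn t ⟨ht.1.le, ht.2⟩) hintd
    linarith

/-! ### Convolution bodies -/

section Convolution

variable {n : ℕ} {K L : Set (EuclideanSpace ℝ (Fin n))}

theorem mem_singleton_sub {x z : EuclideanSpace ℝ (Fin n)} : x ∈ {z} - L ↔ z - x ∈ L := by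
  rw [singleton_sub]
  constructor
  · rintro ⟨y, hy, rfl⟩
    simpa using hy
  · intro h
    exact ⟨z - x, h, by simp⟩

theorem isCompact_singleton_sub (hL : IsCompact L) (z : EuclideanSpace ℝ (Fin n)) :
    IsCompact ({z} - L) := by
  rw [singleton_sub]
  exact hL.image (by fun_prop)

theorem vol_singleton_sub (z : EuclideanSpace ℝ (Fin n)) : vol ({z} - L) = vol L := by
  rw [sub_eq_add_neg, singleton_add, ← vol_neg L, ← vol_vadd z (-L)]
  rfl

theorem isCompact_inter_singleton_sub (hK : IsCompact K) (hL : IsCompact L)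
    (z : EuclideanSpace ℝ (Fin n)) : IsCompact (K ∩ ({z} - L)) :=
  hK.inter (isCompact_singleton_sub hL z)

theorem inter_singleton_sub_nonempty {z : EuclideanSpace ℝ (Fin n)} :
    (K ∩ ({z} - L)).Nonempty ↔ z ∈ K + L := by
  constructor
  · rintro ⟨x, hx, hxz⟩
    exact ⟨x, hx, z - x, mem_singleton_sub.1 hxz, by simp⟩
  · rintro ⟨x, hx, y, hy, rfl⟩
    exact ⟨x, hx, mem_singleton_sub.2 (by simpa using hy)⟩

theorem vol_inter_singleton_sub_of_notMem {z : EuclideanSpace ℝ (Fin n)} (hz : z ∉ K + L) :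
    vol (K ∩ ({z} - L)) = 0 := by
  rw [← inter_singleton_sub_nonempty, not_nonempty_iff_eq_empty] at hz
  rw [hz, vol, measure_empty, ENNReal.toReal_zero]

theorem vol_inter_singleton_sub_le_left (hK : IsCompact K) (z : EuclideanSpace ℝ (Fin n)) :
    vol (K ∩ ({z} - L)) ≤ vol K :=
  vol_mono hK inter_subset_left

theorem vol_inter_singleton_sub_le_right (hL : IsCompact L) (z : EuclideanSpace ℝ (Fin n)) :
    vol (K ∩ ({z} - L)) ≤ vol L :=
  (vol_mono (isCompact_singleton_sub hL z) inter_subset_right).trans_eq (vol_singleton_sub z)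

theorem upperSemicontinuous_vol_inter (hK : IsCompact K) (hL : IsCompact L) :
    UpperSemicontinuous fun z => vol (K ∩ ({z} - L)) := by
  intro z c hc
  have hfin : volume (K ∩ ({z} - L)) ≠ ⊤ :=
    (isCompact_inter_singleton_sub hK hL z).measure_lt_top.ne
  have hc' : volume (K ∩ ({z} - L)) < ENNReal.ofReal c :=
    (ENNReal.lt_ofReal_iff_toReal_lt hfin).2 hc
  obtain ⟨U, hKU, hU, hUc⟩ := (K ∩ ({z} - L)).exists_isOpen_lt_of_lt _ hc'
  -- by compactness of `K \ U` the nearby intersections stay inside `U`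
  have hev : ∀ᶠ w in nhds z, ∀ x ∈ K \ U, w - x ∉ L := by
    refine (hK.diff hU).eventually_forall_of_forall_eventually fun x hx => ?_
    have hzx : z - x ∉ L := fun h => hx.2 (hKU ⟨hx.1, mem_singleton_sub.2 h⟩)
    have ht : Filter.Tendsto (fun p : EuclideanSpace ℝ (Fin n) × EuclideanSpace ℝ (Fin n) =>
        p.1 - p.2) (nhds (z, x)) (nhds (z - x)) := by
      apply Continuous.tendsto' (by fun_prop); rfl
    exact ht.eventually (hL.isClosed.isOpen_compl.eventually_mem hzx)
  filter_upwards [hev] with w hw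
  have hsub : K ∩ ({w} - L) ⊆ U := by
    rintro x ⟨hxK, hxw⟩
    by_contra hxU
    exact hw x ⟨hxK, hxU⟩ (mem_singleton_sub.1 hxw)
  exact (ENNReal.lt_ofReal_iff_toReal_lt
    (isCompact_inter_singleton_sub hK hL w).measure_lt_top.ne).1 ((measure_mono hsub).trans_lt hUc)

theorem vol_inter_singleton_sub_le_max (hK : IsCompact K) (z : EuclideanSpace ℝ (Fin n)) :
    vol (K ∩ ({z} - L)) ≤ maxIntersectionVol K L := by
  refine le_ciSup (f := fun z => vol (K ∩ ({z} - L))) ⟨vol K, ?_⟩ z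
  rintro _ ⟨z, rfl⟩
  exact vol_inter_singleton_sub_le_left hK z

theorem maxIntersectionVol_pos (hK : IsCompact K) (hK' : (interior K).Nonempty)
    (hL' : (interior L).Nonempty) : 0 < maxIntersectionVol K L := by
  obtain ⟨x, hx⟩ := hK'
  obtain ⟨y, hy⟩ := hL'
  refine lt_of_lt_of_le ?_ (vol_inter_singleton_sub_le_max hK (x + y))
  have hopen : IsOpen (interior K ∩ (fun u => x + y - u) ⁻¹' interior L) :=
    isOpen_interior.inter (isOpen_interior.preimage (by fun_prop))
  have hpos := hopen.measure_pos volume ⟨x, hx, by simpa using hy⟩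
  have hsub : interior K ∩ (fun u => x + y - u) ⁻¹' interior L ⊆ K ∩ ({x + y} - L) :=
    fun u hu => ⟨interior_subset hu.1, mem_singleton_sub.2 (interior_subset hu.2)⟩
  refine ENNReal.toReal_pos (hpos.trans_le (measure_mono hsub)).ne' ?_
  exact ((measure_mono inter_subset_left).trans_lt hK.measure_lt_top).ne

theorem exists_vol_inter_eq_max (hK : IsCompact K) (hL : IsCompact L)
    (hK' : (interior K).Nonempty) (hL' : (interior L).Nonempty) :
    ∃ z ∈ K + L, vol (K ∩ ({z} - L)) = maxIntersectionVol K L := by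
  have hne : (K + L).Nonempty :=
    (hK'.mono interior_subset).add (hL'.mono interior_subset)
  obtain ⟨z, hz, hmax⟩ := UpperSemicontinuousOn.exists_isMaxOn hne (hK.add hL)
    ((upperSemicontinuous_vol_inter hK hL).upperSemicontinuousOn _)
  refine ⟨z, hz, le_antisymm (vol_inter_singleton_sub_le_max hK z) (ciSup_le fun w => ?_)⟩
  by_cases hw : w ∈ K + L
  · exact hmax hw
  · rw [vol_inter_singleton_sub_of_notMem hw]
    exact vol_nonneg _

/-- The `n`-th root of `|K ∩ (z - L)| / M(K, L)`. It is concave on `K + L` with maximum `1`. -/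
noncomputable def relOverlap (K L : Set (EuclideanSpace ℝ (Fin n))) (z : EuclideanSpace ℝ (Fin n)) : ℝ :=
  (vol (K ∩ ({z} - L)) / maxIntersectionVol K L) ^ (1 / (n : ℝ))

/-- The superlevel set `{relOverlap ≥ t}` in `K + L`, that is, the convolution body
`K +_θ L` with `θ = tⁿ`. -/
noncomputable def overlapLevel (K L : Set (EuclideanSpace ℝ (Fin n))) (t : ℝ) :
    Set (EuclideanSpace ℝ (Fin n)) :=
  {z | z ∈ K + L ∧ t ≤ relOverlap K L z}

theorem maxIntersectionVol_nonneg : 0 ≤ maxIntersectionVol K L :=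
  Real.iSup_nonneg fun _ => vol_nonneg _

theorem relOverlap_nonneg (z : EuclideanSpace ℝ (Fin n)) : 0 ≤ relOverlap K L z :=
  Real.rpow_nonneg (div_nonneg (vol_nonneg _) maxIntersectionVol_nonneg) _

theorem relOverlap_pow (hn : 1 ≤ n) (z : EuclideanSpace ℝ (Fin n)) :
    relOverlap K L z ^ n = vol (K ∩ ({z} - L)) / maxIntersectionVol K L := by
  rw [relOverlap, one_div, Real.rpow_inv_natCast_pow
    (div_nonneg (vol_nonneg _) maxIntersectionVol_nonneg) (by omega)]

theorem relOverlap_le_one (hK : IsCompact K) (z : EuclideanSpace ℝ (Fin n)) :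
    relOverlap K L z ≤ 1 :=
  Real.rpow_le_one (div_nonneg (vol_nonneg _) maxIntersectionVol_nonneg)
    (div_le_one_of_le₀ (vol_inter_singleton_sub_le_max hK z) maxIntersectionVol_nonneg)
    (by positivity)

theorem relOverlap_of_notMem (hn : 1 ≤ n) {z : EuclideanSpace ℝ (Fin n)} (hz : z ∉ K + L) :
    relOverlap K L z = 0 := by
  rw [relOverlap, vol_inter_singleton_sub_of_notMem hz, zero_div, Real.zero_rpow (by positivity)]

theorem concaveOn_relOverlap (hn : 1 ≤ n) (hK : IsCompact K) (hL : IsCompact L)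
    (hKc : Convex ℝ K) (hLc : Convex ℝ L) : ConcaveOn ℝ (K + L) (relOverlap K L) := by
  refine ⟨hKc.add hLc, fun z hz w hw a b ha hb hab => ?_⟩
  have hM : 0 ≤ maxIntersectionVol K L := maxIntersectionVol_nonneg
  simp only [relOverlap, smul_eq_mul]
  rw [Real.div_rpow (vol_nonneg _) hM, Real.div_rpow (vol_nonneg _) hM,
    Real.div_rpow (vol_nonneg _) hM, mul_div_assoc', mul_div_assoc', ← add_div]
  refine div_le_div_of_nonneg_right ?_ (by positivity)
  rw [← vol_smul_rpow hn ha, ← vol_smul_rpow hn hb]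
  have hz' := inter_singleton_sub_nonempty.2 hz
  have hw' := inter_singleton_sub_nonempty.2 hw
  refine (brunn_minkowski hn ((isCompact_inter_singleton_sub hK hL z).smul a)
    ((isCompact_inter_singleton_sub hK hL w).smul b) hz'.smul_set hw'.smul_set).trans ?_
  refine Real.rpow_le_rpow (vol_nonneg _)
    (vol_mono (isCompact_inter_singleton_sub hK hL _) ?_) (by positivity)
  rintro _ ⟨_, ⟨x, ⟨hxK, hxL⟩, rfl⟩, _, ⟨y, ⟨hyK, hyL⟩, rfl⟩, rfl⟩
  refine ⟨hKc hxK hyK ha hb hab, mem_singleton_sub.2 ?_⟩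
  rw [mem_singleton_sub] at hxL hyL
  have := hLc hxL hyL ha hb hab
  convert this using 1
  simp only [smul_sub]
  abel

theorem thetaConvolution_eq_overlapLevel (hn : 1 ≤ n) (hM : 0 < maxIntersectionVol K L) {θ : ℝ}
    (hθ : 0 ≤ θ) : thetaConvolution θ K L = overlapLevel K L (θ ^ (1 / (n : ℝ))) := by
  ext z
  refine and_congr_right fun _ => ?_
  rw [relOverlap, Real.rpow_le_rpow_iff hθ (div_nonneg (vol_nonneg _) hM.le) (by positivity),
    le_div_iff₀ hM]

theorem overlapLevel_zero : overlapLevel K L 0 = K + L := by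
  ext z
  simp [overlapLevel, relOverlap_nonneg]

theorem overlapLevel_anti {s t : ℝ} (hst : s ≤ t) : overlapLevel K L t ⊆ overlapLevel K L s :=
  fun _ hz => ⟨hz.1, hst.trans hz.2⟩

theorem upperSemicontinuous_relOverlap (hK : IsCompact K) (hL : IsCompact L) :
    UpperSemicontinuous (relOverlap K L) := by
  have hM : 0 ≤ maxIntersectionVol K L := maxIntersectionVol_nonneg
  have hmono : Monotone fun x : ℝ => (max x 0 / maxIntersectionVol K L) ^ (1 / (n : ℝ)) := by
    intro x y hxy
    exact Real.rpow_le_rpow (by positivity)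
      (div_le_div_of_nonneg_right (max_le_max_right 0 hxy) hM) (by positivity)
  have hcont : Continuous fun x : ℝ => (max x 0 / maxIntersectionVol K L) ^ (1 / (n : ℝ)) :=
    Continuous.rpow_const (by fun_prop) fun x => Or.inr (by positivity)
  have := hcont.comp_upperSemicontinuous (upperSemicontinuous_vol_inter hK hL) hmono
  convert! this using 1
  ext z
  simp [relOverlap, max_eq_left (vol_nonneg _)]

theorem isCompact_overlapLevel (hK : IsCompact K) (hL : IsCompact L) (t : ℝ) :
    IsCompact (overlapLevel K L t) :=
  (hK.add hL).inter_right ((upperSemicontinuous_relOverlap hK hL).isClosed_preimage t)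

theorem convex_overlapLevel (hn : 1 ≤ n) (hK : IsCompact K) (hL : IsCompact L)
    (hKc : Convex ℝ K) (hLc : Convex ℝ L) (t : ℝ) : Convex ℝ (overlapLevel K L t) :=
  (concaveOn_relOverlap hn hK hL hKc hLc).convex_ge t

theorem exists_relOverlap_eq_one (hK : IsCompact K) (hL : IsCompact L)
    (hK' : (interior K).Nonempty) (hL' : (interior L).Nonempty) :
    ∃ z ∈ K + L, relOverlap K L z = 1 := by
  obtain ⟨z, hz, hmax⟩ := exists_vol_inter_eq_max hK hL hK' hL'
  refine ⟨z, hz, ?_⟩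
  rw [relOverlap, hmax, div_self (maxIntersectionVol_pos hK hK' hL').ne', Real.one_rpow]

/-- The `n`-th root of the volume of the convolution body at level `tⁿ`. -/
noncomputable def levelRadius (K L : Set (EuclideanSpace ℝ (Fin n))) (t : ℝ) : ℝ :=
  vol (overlapLevel K L t) ^ (1 / (n : ℝ))

theorem levelRadius_nonneg (t : ℝ) : 0 ≤ levelRadius K L t :=
  Real.rpow_nonneg (vol_nonneg _) _

theorem levelRadius_pow (hn : 1 ≤ n) (t : ℝ) :
    levelRadius K L t ^ n = vol (overlapLevel K L t) := by
  rw [levelRadius, one_div, Real.rpow_inv_natCast_pow (vol_nonneg _) (by omega)]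

theorem levelRadius_antitone (hK : IsCompact K) (hL : IsCompact L) :
    Antitone (levelRadius K L) := fun s _ hst =>
  Real.rpow_le_rpow (vol_nonneg _) (vol_mono (isCompact_overlapLevel hK hL s)
    (overlapLevel_anti hst)) (by positivity)

theorem concaveOn_levelRadius (hn : 1 ≤ n) (hK : IsCompact K) (hL : IsCompact L)
    (hKc : Convex ℝ K) (hLc : Convex ℝ L) (hK' : (interior K).Nonempty)
    (hL' : (interior L).Nonempty) : ConcaveOn ℝ (Icc 0 1) (levelRadius K L) := by
  refine ⟨convex_Icc 0 1, fun s hs t ht a b ha hb hab => ?_⟩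
  obtain ⟨z, hz, hz1⟩ := exists_relOverlap_eq_one hK hL hK' hL'
  have hne : ∀ t ∈ Icc (0 : ℝ) 1, (overlapLevel K L t).Nonempty := fun t ht =>
    ⟨z, hz, ht.2.trans_eq hz1.symm⟩
  simp only [levelRadius, smul_eq_mul]
  rw [← vol_smul_rpow hn ha, ← vol_smul_rpow hn hb]
  refine (brunn_minkowski hn ((isCompact_overlapLevel hK hL s).smul a)
    ((isCompact_overlapLevel hK hL t).smul b) (hne s hs).smul_set (hne t ht).smul_set).trans ?_
  refine Real.rpow_le_rpow (vol_nonneg _)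
    (vol_mono (isCompact_overlapLevel hK hL _) ?_) (by positivity)
  rintro _ ⟨_, ⟨x, hx, rfl⟩, _, ⟨y, hy, rfl⟩, rfl⟩
  have hconc := concaveOn_relOverlap hn hK hL hKc hLc
  refine ⟨hconc.1 hx.1 hy.1 ha hb hab, le_trans ?_ (hconc.2 hx.1 hy.1 ha hb hab)⟩
  exact add_le_add (mul_le_mul_of_nonneg_left hx.2 ha) (mul_le_mul_of_nonneg_left hy.2 hb)

theorem lintegral_volume_inter (hK : IsCompact K) (hL : IsCompact L) :
    ∫⁻ z, volume (K ∩ ({z} - L)) = volume K * volume L := by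
  have h1 : ∀ z, volume (K ∩ ({z} - L)) = ∫⁻ x, K.indicator 1 x * L.indicator 1 (z - x) := by
    intro z
    rw [← lintegral_indicator_one (isCompact_inter_singleton_sub hK hL z).measurableSet]
    refine lintegral_congr fun x => ?_
    have : x ∈ {z} - L ↔ z - x ∈ L := mem_singleton_sub
    by_cases hx : x ∈ K <;> by_cases hy : z - x ∈ L <;> simp [indicator, hx, hy, this, -singleton_sub]
  have mK : Measurable (K.indicator (1 : EuclideanSpace ℝ (Fin n) → ENNReal)) :=
    measurable_one.indicator hK.measurableSet
  have mL : Measurable (L.indicator (1 : EuclideanSpace ℝ (Fin n) → ENNReal)) :=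
    measurable_one.indicator hL.measurableSet
  simp only [h1]
  rw [lintegral_lintegral_swap]
  · have h2 : ∀ x, ∫⁻ z, K.indicator 1 x * L.indicator 1 (z - x) =
        K.indicator 1 x * volume L := by
      intro x
      rw [lintegral_const_mul _ (by fun_prop),
        lintegral_sub_right_eq_self (μ := volume) (L.indicator 1) x,
        lintegral_indicator_one hL.measurableSet]
    simp only [h2]
    rw [lintegral_mul_const _ mK, lintegral_indicator_one hK.measurableSet]
  · apply Measurable.aemeasurable
    apply Measurable.mul
    · exact mK.comp measurable_snd
    · exact mL.comp (measurable_fst.sub measurable_snd)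

/-- Integrating `|K ∩ (z - L)|` over `z` by layers expresses `|K| |L| / M(K, L)` through the volumes
of the convolution bodies. -/
theorem integral_levelRadius (hn : 1 ≤ n) (hK : IsCompact K) (hL : IsCompact L)
    (hK' : (interior K).Nonempty) (hL' : (interior L).Nonempty) :
    ∫ t in (0 : ℝ)..1, n * t ^ (n - 1) * levelRadius K L t ^ n =
      vol K * vol L / maxIntersectionVol K L := by
  have hM : 0 < maxIntersectionVol K L := maxIntersectionVol_pos hK hK' hL'
  have hmeas : Measurable (relOverlap K L) := (upperSemicontinuous_relOverlap hK hL).measurable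
  have hprim : ∀ u : ℝ, ∫ t in (0 : ℝ)..u, n * t ^ (n - 1) = u ^ n := by
    intro u
    have e' : ((n - 1 : ℕ) : ℝ) + 1 = n := by exact_mod_cast (by omega : n - 1 + 1 = n)
    have hn0 : (n : ℝ) ≠ 0 := by positivity
    rw [intervalIntegral.integral_const_mul, integral_pow, e', show n - 1 + 1 = n by omega,
      zero_pow (by omega), sub_zero]
    field_simp
  have hlayer := lintegral_comp_eq_lintegral_meas_le_mul (volume : Measure (EuclideanSpace ℝ (Fin n)))
    (f := relOverlap K L) (g := fun t => n * t ^ (n - 1))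
    (Filter.Eventually.of_forall relOverlap_nonneg) hmeas.aemeasurable
    (fun t _ => by apply Continuous.intervalIntegrable; fun_prop)
    ((ae_restrict_iff' measurableSet_Ioi).2 (Filter.Eventually.of_forall fun t (ht : 0 < t) => by
      positivity))
  simp only [hprim, relOverlap_pow hn] at hlayer
  have hlhs : ∫⁻ z, ENNReal.ofReal (vol (K ∩ ({z} - L)) / maxIntersectionVol K L) =
      ENNReal.ofReal (vol K * vol L / maxIntersectionVol K L) := by
    have : ∀ z, ENNReal.ofReal (vol (K ∩ ({z} - L)) / maxIntersectionVol K L) =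
        volume (K ∩ ({z} - L)) * ENNReal.ofReal (maxIntersectionVol K L)⁻¹ := by
      intro z
      rw [div_eq_mul_inv, ENNReal.ofReal_mul (vol_nonneg _), vol,
        ENNReal.ofReal_toReal (isCompact_inter_singleton_sub hK hL z).measure_lt_top.ne]
    simp only [this]
    rw [lintegral_mul_const' _ _ ENNReal.ofReal_ne_top, lintegral_volume_inter hK hL,
      div_eq_mul_inv, ENNReal.ofReal_mul (by have := vol_nonneg K; have := vol_nonneg L; positivity),
      ENNReal.ofReal_mul (vol_nonneg _), vol, vol,
      ENNReal.ofReal_toReal hK.measure_lt_top.ne, ENNReal.ofReal_toReal hL.measure_lt_top.ne]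
  have hset : ∀ t : ℝ, 0 < t → {z | t ≤ relOverlap K L z} = overlapLevel K L t := by
    intro t ht
    ext z
    refine ⟨fun h => ⟨?_, h⟩, fun h => h.2⟩
    by_contra hz
    have h' : t ≤ relOverlap K L z := h
    rw [relOverlap_of_notMem hn hz] at h'
    linarith
  have hrhs : ∫⁻ t in Ioi (0 : ℝ), volume {z | t ≤ relOverlap K L z} *
      ENNReal.ofReal (n * t ^ (n - 1)) =
      ∫⁻ t in Ioc (0 : ℝ) 1, ENNReal.ofReal (n * t ^ (n - 1) * levelRadius K L t ^ n) := by
    rw [← Ioc_union_Ioi_eq_Ioi (zero_le_one : (0 : ℝ) ≤ 1),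
      lintegral_union measurableSet_Ioi (Ioc_disjoint_Ioi le_rfl)]
    have hzero : ∫⁻ t in Ioi (1 : ℝ), volume {z | t ≤ relOverlap K L z} *
        ENNReal.ofReal (n * t ^ (n - 1)) = 0 := by
      rw [setLIntegral_congr_fun (g := fun _ => 0) measurableSet_Ioi, lintegral_zero]
      intro t (ht : 1 < t)
      have : {z | t ≤ relOverlap K L z} = ∅ := by
        refine eq_empty_of_forall_notMem fun z (hz : t ≤ _) => ?_
        linarith [relOverlap_le_one hK (L := L) z]
      simp [this]
    rw [hzero, add_zero]
    refine setLIntegral_congr_fun measurableSet_Ioc fun t ht => ?_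
    have ht0 := ht.1
    rw [hset t ht.1, levelRadius_pow hn, ENNReal.ofReal_mul (p := n * t ^ (n - 1)) (by positivity), vol,
      ENNReal.ofReal_toReal (isCompact_overlapLevel hK hL t).measure_lt_top.ne, mul_comm]
  rw [hlhs, hrhs] at hlayer
  have hpos : 0 ≤ vol K * vol L / maxIntersectionVol K L :=
    div_nonneg (mul_nonneg (vol_nonneg _) (vol_nonneg _)) hM.le
  rw [intervalIntegral.integral_of_le zero_le_one, integral_eq_lintegral_of_nonneg_ae, ← hlayer,
    ENNReal.toReal_ofReal hpos]
  · refine (ae_restrict_iff' measurableSet_Ioc).2 (Filter.Eventually.of_forall fun t ht => ?_)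
    have := ht.1
    have := levelRadius_nonneg (K := K) (L := L) t
    simp only [Pi.zero_apply]
    positivity
  · exact (((levelRadius_antitone hK hL).antitoneOn _).intervalIntegrable_pow
      (fun t _ => levelRadius_nonneg t) n).1.aestronglyMeasurable

theorem vol_pos_of_interior (hK : IsCompact K) (hK' : (interior K).Nonempty) : 0 < vol K :=
  ENNReal.toReal_pos (Measure.measure_pos_of_nonempty_interior _ hK').ne' hK.measure_lt_top.ne

/-- A compact subset of a convex set of the same volume is the whole set. -/
theorem eq_of_subset_of_vol_le {A B : Set (EuclideanSpace ℝ (Fin n))} (hA : IsCompact A)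
    (hB : IsCompact B) (hBc : Convex ℝ B) (hBpos : 0 < vol B) (hAB : A ⊆ B)
    (hvol : vol B ≤ vol A) : A = B := by
  have hint : (interior B).Nonempty := by
    by_contra h
    rw [not_nonempty_iff_eq_empty] at h
    have hf := hBc.addHaar_frontier volume
    rw [frontier, h, sdiff_empty, hB.isClosed.closure_eq] at hf
    simp [vol, hf] at hBpos
  have hle : volume B ≤ volume A :=
    (ENNReal.toReal_le_toReal hB.measure_lt_top.ne hA.measure_lt_top.ne).1 hvol
  have hdiff : volume (B \ A) = 0 := by
    rw [measure_sdiff hAB hA.measurableSet.nullMeasurableSet hA.measure_lt_top.ne]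
    exact tsub_eq_zero_of_le hle
  have hsub : interior B ⊆ A := by
    have hopen : IsOpen (interior B \ A) := isOpen_interior.sdiff hA.isClosed
    have h0 : volume (interior B \ A) = 0 :=
      measure_mono_null (sdiff_subset_sdiff_left interior_subset) hdiff
    have := hopen.measure_eq_zero_iff volume |>.1 h0
    exact sdiff_eq_empty.1 this
  refine hAB.antisymm ?_
  calc B ⊆ closure B := subset_closure
    _ = closure (interior B) := (hBc.closure_interior_eq_closure_of_nonempty_interior hint).symm
    _ ⊆ A := closure_minimal hsub hA.isClosed

end Convolution

/-! ### Bodies whose intersections with their translates are homothetic to them -/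

section Cone

variable {E : Type*} [AddCommGroup E] [Module ℝ E] {K : Set E}

/-- Membership of `(x, t)` in the cone over `K × {1}`, that is, `0 ≤ t` and `x ∈ t • K`. The cone
defines the order on `E × ℝ` in which the least upper bounds below are taken. -/
def InCone (K : Set E) (x : E) (t : ℝ) : Prop :=
  0 ≤ t ∧ ∃ k ∈ K, x = t • k

theorem InCone.smul_mem {x : E} {t : ℝ} (ht : 0 ≤ t) (hx : x ∈ K) : InCone K (t • x) t :=
  ⟨ht, x, hx, rfl⟩

theorem InCone.add (hK : Convex ℝ K) {x y : E} {s t : ℝ} (hx : InCone K x s) (hy : InCone K y t) :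
    InCone K (x + y) (s + t) := by
  obtain ⟨hs, k, hk, rfl⟩ := hx
  obtain ⟨ht, l, hl, rfl⟩ := hy
  rcases (add_nonneg hs ht).eq_or_lt with h0 | hpos
  · have h1 : s = 0 := by linarith
    have h2 : t = 0 := by linarith
    exact ⟨by linarith, k, hk, by simp [h1, h2]⟩
  · refine ⟨hpos.le, (s / (s + t)) • k + (t / (s + t)) • l,
      hK hk hl (by positivity) (by positivity) (by field_simp), ?_⟩
    rw [smul_add, smul_smul, smul_smul, mul_div_cancel₀ _ hpos.ne', mul_div_cancel₀ _ hpos.ne']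

/-- For distinct extreme points `e`, `e'` of `K`, every nonempty `K ∩ (μ (e' - e) + K)` is the image
of `K` under the homothety with centre `e'` and ratio `1 - μ ≥ 0`. -/
def HomotheticAtExtremePoints (K : Set E) : Prop :=
  ∀ e ∈ K.extremePoints ℝ, ∀ e' ∈ K.extremePoints ℝ, e ≠ e' → ∀ μ : ℝ, 0 ≤ μ →
    ∀ y ∈ K, y - μ • (e' - e) ∈ K → μ ≤ 1 ∧ ∃ k ∈ K, y = (1 - μ) • k + μ • e'

/-- The least upper bound of the equal multiples `ε (e, 1)` and `ε (e', 1)` in the cone order is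
their sum. -/
theorem HomotheticAtExtremePoints.add_le (hH : HomotheticAtExtremePoints K) {e e' : E}
    (he : e ∈ K.extremePoints ℝ) (he' : e' ∈ K.extremePoints ℝ) (hne : e ≠ e') {ε : ℝ}
    (hε : 0 < ε) {s : E} {t : ℝ} (h : InCone K (s - ε • e) (t - ε))
    (h' : InCone K (s - ε • e') (t - ε)) : InCone K (s - ε • e - ε • e') (t - ε - ε) := by
  obtain ⟨h0, k, hk, hk'⟩ := h
  obtain ⟨-, l, hl, hl'⟩ := h'
  rcases h0.eq_or_lt with h0 | hpos
  · rw [← h0, zero_smul, sub_eq_zero] at hk' hl'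
    exact absurd (smul_right_injective E hε.ne' (hk'.symm.trans hl')) hne
  have hkl : k - (ε / (t - ε)) • (e' - e) = l := by
    apply smul_right_injective E hpos.ne'
    simp only
    rw [smul_sub, smul_smul, mul_div_cancel₀ _ hpos.ne', ← hk', ← hl', smul_sub]
    abel
  obtain ⟨h1, m, hm, hm'⟩ := hH e he e' he' hne (ε / (t - ε)) (by positivity) k hk (hkl ▸ hl)
  have h2 : ε ≤ t - ε := by rwa [div_le_one hpos] at h1
  refine ⟨by linarith, m, hm, ?_⟩
  rw [hk', hm', smul_add, smul_smul, smul_smul, mul_div_cancel₀ _ hpos.ne', add_sub_cancel_right,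
    mul_sub, mul_div_cancel₀ _ hpos.ne', mul_one]

theorem HomotheticAtExtremePoints.nsmul_add_le (hK : Convex ℝ K)
    (hH : HomotheticAtExtremePoints K) {e e' : E}
    (he : e ∈ K.extremePoints ℝ) (he' : e' ∈ K.extremePoints ℝ) (hne : e ≠ e') {ε : ℝ}
    (hε : 0 < ε) (N : ℕ) : ∀ (s : E) (t : ℝ), InCone K (s - (N * ε) • e) (t - N * ε) →
    InCone K (s - ε • e') (t - ε) → InCone K (s - (N * ε) • e - ε • e') (t - N * ε - ε) := by
  induction N with
  | zero => intro s t _ h'; simpa using h'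
  | succ N ih =>
    intro s t h h'
    have e1 : s - ((N + 1 : ℕ) * ε) • e = s - ε • e - (N * ε) • e := by
      push_cast; module
    have e2 : t - (N + 1 : ℕ) * ε = t - ε - N * ε := by push_cast; ring
    rw [e1, e2] at h ⊢
    have h1 : InCone K (s - ε • e) (t - ε) := by
      have := h.add hK (InCone.smul_mem (show 0 ≤ N * ε by positivity) he.1)
      simpa using this
    exact ih _ _ h (hH.add_le he he' hne hε h1 h')

theorem HomotheticAtExtremePoints.exists_pos_le (hK : Convex ℝ K)
    (hH : HomotheticAtExtremePoints K) {e e' : E}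
    (he : e ∈ K.extremePoints ℝ) (he' : e' ∈ K.extremePoints ℝ) (hne : e ≠ e') {a : ℝ}
    (ha : 0 < a) {s : E} {t : ℝ} (h : InCone K (s - a • e) (t - a))
    (h' : ∃ ε > 0, InCone K (s - ε • e') (t - ε)) :
    ∃ ε > 0, InCone K (s - a • e - ε • e') (t - a - ε) := by
  obtain ⟨ε, hε, hc⟩ := h'
  obtain ⟨N, hN⟩ := exists_nat_gt (a / ε)
  have hNpos : (0 : ℝ) < N := (by positivity : 0 < a / ε).trans hN
  have hle : a / N ≤ ε := by
    rw [div_lt_iff₀ hε] at hN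
    rw [div_le_iff₀ hNpos]
    linarith
  have hmul : N * (a / N) = a := mul_div_cancel₀ _ hNpos.ne'
  refine ⟨a / N, by positivity, ?_⟩
  have key := hH.nsmul_add_le hK he he' hne (show 0 < a / N by positivity) N s t
  rw [hmul] at key
  refine key h ?_
  have := hc.add hK (InCone.smul_mem (sub_nonneg.2 hle) he'.1)
  convert this using 1
  · module
  · ring

theorem InCone.sum (hK : Convex ℝ K) (hne : K.Nonempty) {ι : Type*} (I : Finset ι) (p : ι → E)
    (a : ι → ℝ) (hp : ∀ i ∈ I, p i ∈ K) (ha : ∀ i ∈ I, 0 ≤ a i) :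
    InCone K (∑ i ∈ I, a i • p i) (∑ i ∈ I, a i) := by
  classical
  induction I using Finset.induction_on with
  | empty =>
    obtain ⟨k, hk⟩ := hne
    exact ⟨by simp, k, hk, by simp⟩
  | insert j I hj ih =>
    rw [Finset.sum_insert hj, Finset.sum_insert hj]
    refine InCone.add hK (InCone.smul_mem (ha j (by simp)) (hp j (by simp))) (ih ?_ ?_)
    · exact fun i hi => hp i (Finset.mem_insert_of_mem hi)
    · exact fun i hi => ha i (Finset.mem_insert_of_mem hi)

/-- No positive multiple of an extreme point lies below a combination of other extreme points. -/
theorem HomotheticAtExtremePoints.not_le_sum (hK : Convex ℝ K)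
    (hH : HomotheticAtExtremePoints K) {e' : E} (he' : e' ∈ K.extremePoints ℝ) {ι : Type*}
    (I : Finset ι) (p : ι → E) (a : ι → ℝ) (hp : ∀ i ∈ I, p i ∈ K.extremePoints ℝ)
    (hne : ∀ i ∈ I, p i ≠ e') (ha : ∀ i ∈ I, 0 < a i) :
    ¬ ∃ ε > 0, InCone K (∑ i ∈ I, a i • p i - ε • e') (∑ i ∈ I, a i - ε) := by
  classical
  induction I using Finset.induction_on with
  | empty =>
    rintro ⟨ε, hε, h, -⟩
    simp only [Finset.sum_empty] at h
    linarith
  | insert j I hj ih =>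
    intro h
    have hp' : ∀ i ∈ I, p i ∈ K.extremePoints ℝ := fun i hi => hp i (Finset.mem_insert_of_mem hi)
    have ha' : ∀ i ∈ I, 0 < a i := fun i hi => ha i (Finset.mem_insert_of_mem hi)
    refine ih hp' (fun i hi => hne i (Finset.mem_insert_of_mem hi)) ha' ?_
    have hsum := InCone.sum hK ⟨e', he'.1⟩ I p a (fun i hi => (hp' i hi).1)
      (fun i hi => (ha' i hi).le)
    rw [Finset.sum_insert hj, Finset.sum_insert hj] at h
    have key := hH.exists_pos_le hK (hp j (by simp)) he' (hne j (by simp)) (ha j (by simp))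
      (s := a j • p j + ∑ i ∈ I, a i • p i) (t := a j + ∑ i ∈ I, a i)
      (by simpa using hsum) h
    simpa using key

theorem HomotheticAtExtremePoints.affineIndependent (hK : Convex ℝ K)
    (hH : HomotheticAtExtremePoints K) :
    AffineIndependent ℝ (Subtype.val : K.extremePoints ℝ → E) := by
  classical
  rw [affineIndependent_iff]
  intro s w hw hwp
  by_contra! hcon
  obtain ⟨i, his, hi⟩ := hcon
  obtain ⟨j, hjs, hj⟩ : ∃ j ∈ s, w j < 0 := by
    by_contra! hnn
    exact hi ((Finset.sum_eq_zero_iff_of_nonneg hnn).1 hw i his)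
  refine hH.not_le_sum hK j.2 (s.filter fun i => 0 < w i) Subtype.val w (fun i _ => i.2) ?_ ?_
    ⟨-w j, by linarith, ?_⟩
  · intro i hi h
    rw [Subtype.val_injective h] at hi
    linarith [(Finset.mem_filter.1 hi).2]
  · exact fun i hi => (Finset.mem_filter.1 hi).2
  · -- the difference is the combination of the remaining points of negative weight
    have hjm : j ∈ s.filter fun i => ¬ 0 < w i := Finset.mem_filter.2 ⟨hjs, by linarith⟩
    have hsplit := Finset.sum_filter_add_sum_filter_not s (fun i => 0 < w i) w
    have hsplit' := Finset.sum_filter_add_sum_filter_not s (fun i => 0 < w i)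
      (fun i => w i • (i : E))
    rw [hw, ← Finset.add_sum_erase _ _ hjm] at hsplit
    rw [hwp, ← Finset.add_sum_erase _ _ hjm] at hsplit'
    have hsum := InCone.sum hK ⟨j, j.2.1⟩ ((s.filter fun i => ¬ 0 < w i).erase j) Subtype.val
      (fun i => - w i) (fun i _ => i.2.1) (fun i hi => by
        have := (Finset.mem_filter.1 (Finset.mem_of_mem_erase hi)).2
        linarith)
    simp only [neg_smul, Finset.sum_neg_distrib] at hsum
    convert hsum using 1
    · rw [neg_smul, sub_neg_eq_add, ← sub_eq_zero, ← hsplit']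
      abel
    · linarith

end Cone

section Simplex

variable {n : ℕ} {K L : Set (EuclideanSpace ℝ (Fin n))}

theorem HomotheticAtExtremePoints.isFullSimplex (hK : IsCompact K) (hKc : Convex ℝ K)
    (hK' : (interior K).Nonempty) (hH : HomotheticAtExtremePoints K) : IsFullSimplex K := by
  have hind := hH.affineIndependent hKc
  have hfin : (K.extremePoints ℝ).Finite := finite_set_of_fin_dim_affineIndependent ℝ hind
  have hconv : convexHull ℝ (K.extremePoints ℝ) = K := by
    rw [← hfin.isCompact_convexHull (𝕜 := ℝ) |>.isClosed.closure_eq]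
    exact closure_convexHull_extremePoints hK hKc
  have hspan : affineSpan ℝ (K.extremePoints ℝ) = ⊤ := by
    rw [← interior_convexHull_nonempty_iff_affineSpan_eq_top, hconv]
    exact hK'
  have := hfin.fintype
  have hcard := (hind.affineSpan_eq_top_iff_card_eq_finrank_add_one).1
    (by rw [Subtype.range_coe]; exact hspan)
  rw [finrank_euclideanSpace_fin] at hcard
  let φ : Fin (n + 1) ≃ K.extremePoints ℝ := (Fintype.equivFinOfCardEq hcard).symm
  refine ⟨⟨fun i => φ i, hind.comp_embedding φ.toEmbedding⟩, ?_⟩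
  have hr : range (fun i => (φ i : EuclideanSpace ℝ (Fin n))) = K.extremePoints ℝ := by
    rw [show (fun i => (φ i : EuclideanSpace ℝ (Fin n))) = Subtype.val ∘ φ from rfl,
      φ.surjective.range_comp, Subtype.range_coe]
  simp only [hr, hconv]

theorem eq_zero_of_forall_add_mem (hK : IsCompact K) (hne : K.Nonempty)
    {v : EuclideanSpace ℝ (Fin n)} (h : ∀ k ∈ K, k + v ∈ K) : v = 0 := by
  obtain ⟨k, hk, hmax⟩ := hK.exists_isMaxOn hne (f := fun x => inner ℝ v x) (by fun_prop)
  have hle : inner ℝ v (k + v) ≤ inner ℝ v k := hmax (h k hk)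
  rw [inner_add_right] at hle
  exact real_inner_self_nonpos.1 (by linarith)

theorem vol_vadd_smul {r : ℝ} (hr : 0 ≤ r) (x : EuclideanSpace ℝ (Fin n)) :
    vol (x +ᵥ r • K) = r ^ n * vol K := by
  rw [vol_vadd, vol_smul hr]

theorem mem_inter_singleton_sub_iff {w y z : EuclideanSpace ℝ (Fin n)} :
    y ∈ K ∩ ({z + w} - ({z} - K)) ↔ y ∈ K ∧ y - w ∈ K := by
  rw [mem_inter_iff, mem_singleton_sub, mem_singleton_sub]
  refine and_congr_right fun _ => ?_
  rw [show z - (z + w - y) = y - w by abel]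

theorem inter_singleton_sub_self (z : EuclideanSpace ℝ (Fin n)) :
    K ∩ ({z} - ({z} - K)) = K := by
  ext y
  have := mem_inter_singleton_sub_iff (K := K) (w := 0) (y := y) (z := z)
  simp only [add_zero, sub_zero, and_self] at this
  exact this

theorem maxIntersectionVol_singleton_sub (hK : IsCompact K) (z : EuclideanSpace ℝ (Fin n)) :
    maxIntersectionVol K ({z} - K) = vol K := by
  refine le_antisymm (ciSup_le fun w => vol_inter_singleton_sub_le_left hK w) ?_
  calc vol K = vol (K ∩ ({z} - ({z} - K))) := by rw [inter_singleton_sub_self]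
    _ ≤ _ := vol_inter_singleton_sub_le_max hK z

/-- If the convolution bodies of `K` and `z - K` shrink linearly, then the intersections of `K` with
its translates along differences of extreme points are homothetic to `K`. A homothet of the right
volume always lies in such an intersection, and there is no room for anything more. -/
theorem homotheticAtExtremePoints_of_vol_overlapLevel (hn : 1 ≤ n) (hK : IsCompact K)
    (hKc : Convex ℝ K) (hK' : (interior K).Nonempty) (z : EuclideanSpace ℝ (Fin n))
    (hvol : ∀ t ∈ Ico (0 : ℝ) 1, vol (overlapLevel K ({z} - K) t) =
      (1 - t) ^ n * vol (K + ({z} - K))) :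
    HomotheticAtExtremePoints K := by
  set L := {z} - K with hLdef
  have hL : IsCompact L := isCompact_singleton_sub hK z
  have hLc : Convex ℝ L := (convex_singleton z).sub hKc
  have hKpos := vol_pos_of_interior hK hK'
  have hKne : K.Nonempty := hK'.mono interior_subset
  have hKLc := hK.add hL
  have hM : maxIntersectionVol K L = vol K := maxIntersectionVol_singleton_sub hK z
  set F : EuclideanSpace ℝ (Fin n) → ℝ := fun w => relOverlap K L (z + w) with hF
  have hF1 : ∀ w, F w ≤ 1 := fun w => relOverlap_le_one hK _
  have hF0 : ∀ w, 0 ≤ F w := fun w => relOverlap_nonneg _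
  have hFz : relOverlap K L z = 1 := by
    rw [relOverlap, inter_singleton_sub_self, hM, div_self hKpos.ne', Real.one_rpow]
  have hFvol : ∀ w, vol (K ∩ ({z + w} - L)) = F w ^ n * vol K := by
    intro w
    rw [hF, relOverlap_pow hn, hM, div_mul_cancel₀ _ hKpos.ne']
  have hzKL : ∀ x ∈ K, ∀ x' ∈ K, z + (x - x') ∈ K + L := by
    intro x hx x' hx'
    exact ⟨x, hx, z - x', mem_singleton_sub.2 (by simpa using hx'), by simp only; abel⟩
  have hzm : z ∈ K + L := by
    obtain ⟨x, hx⟩ := hKne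
    simpa using hzKL x hx x hx
  have hconc := concaveOn_relOverlap hn hK hL hKc hLc
  have hFconc : ∀ x ∈ K, ∀ x' ∈ K, ∀ r ∈ Icc (0 : ℝ) 1, 1 - r ≤ F (r • (x - x')) := by
    intro x hx x' hx' r hr
    have := hconc.2 hzm (hzKL x hx x' hx') (sub_nonneg.2 hr.2) hr.1 (by ring)
    rw [hFz, smul_eq_mul, smul_eq_mul, mul_one] at this
    have h2 : 0 ≤ r * relOverlap K L (z + (x - x')) := mul_nonneg hr.1 (relOverlap_nonneg _)
    have h3 : (1 - r) • z + r • (z + (x - x')) = z + r • (x - x') := by module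
    rw [h3] at this
    simp only [hF]
    linarith
  -- superlevel sets of `F` below level one are dilates of `K - K`
  have hlevel : ∀ w, ∀ t ∈ Ico (0 : ℝ) 1, t ≤ F w → 0 < F w →
      ∃ x ∈ K, ∃ x' ∈ K, w = (1 - t) • (x - x') := by
    intro w t ht htF hFpos
    have hsub : t • z +ᵥ (1 - t) • (K + L) ⊆ overlapLevel K L t := by
      rintro _ ⟨_, ⟨u, hu, rfl⟩, rfl⟩
      have hle := hconc.2 hzm hu ht.1 (sub_nonneg.2 ht.2.le) (by ring)
      refine ⟨hconc.1 hzm hu ht.1 (sub_nonneg.2 ht.2.le) (by ring), ?_⟩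
      rw [hFz, smul_eq_mul, smul_eq_mul, mul_one] at hle
      have := mul_nonneg (sub_nonneg.2 ht.2.le) (relOverlap_nonneg (K := K) (L := L) u)
      simp only [vadd_eq_add]
      linarith
    have hpos : 0 < (1 - t) ^ n * vol (K + L) := by
      have : 0 < vol (K + L) := by
        refine hKpos.trans_le ?_
        obtain ⟨y, hy⟩ : L.Nonempty := by
          obtain ⟨x, hx⟩ := hKne
          exact ⟨z - x, mem_singleton_sub.2 (by simpa using hx)⟩
        rw [← vol_vadd y K]
        refine vol_mono hKLc ?_
        rintro _ ⟨x, hx, rfl⟩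
        exact ⟨x, hx, y, hy, add_comm _ _⟩
      have := sub_pos.2 ht.2
      positivity
    have heq := eq_of_subset_of_vol_le ((hKLc.smul (1 - t)).vadd (t • z))
      (isCompact_overlapLevel hK hL t) (convex_overlapLevel hn hK hL hKc hLc t)
      (by rw [hvol t ht]; exact hpos) hsub
      (by rw [hvol t ht, vol_vadd_smul (sub_nonneg.2 ht.2.le)])
    have hmem : z + w ∈ overlapLevel K L t := by
      refine ⟨?_, htF⟩
      by_contra hw
      have := relOverlap_of_notMem hn hw
      simp only [hF] at hFpos
      linarith
    rw [← heq] at hmem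
    obtain ⟨_, ⟨_, ⟨x, hx, y, hy, rfl⟩, rfl⟩, hxy⟩ := hmem
    rw [mem_singleton_sub] at hy
    refine ⟨x, hx, z - y, hy, ?_⟩
    simp only [vadd_eq_add] at hxy
    have : w = t • z + (1 - t) • (x + y) - z := by rw [hxy]; abel
    rw [this]
    module
  -- an intersection at least contains a homothet through each of its points
  have hsub : ∀ (v y : EuclideanSpace ℝ (Fin n)) (μ : ℝ), 0 ≤ μ → μ ≤ 1 → y ∈ K → y - v ∈ K →
      μ • y +ᵥ (1 - μ) • K ⊆ K ∩ ({z + μ • v} - L) := by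
    rintro v y μ h0 h1 hy hyv _ ⟨_, ⟨k, hk, rfl⟩, rfl⟩
    rw [mem_inter_singleton_sub_iff]
    refine ⟨hKc hy hk h0 (sub_nonneg.2 h1) (by ring), ?_⟩
    convert hKc hyv hk h0 (sub_nonneg.2 h1) (by ring) using 1
    simp only [vadd_eq_add]
    module
  have hhom : ∀ (v y : EuclideanSpace ℝ (Fin n)) (μ : ℝ), 0 ≤ μ → μ < 1 → y ∈ K → y - v ∈ K →
      F (μ • v) ≤ 1 - μ → μ • y +ᵥ (1 - μ) • K = K ∩ ({z + μ • v} - L) := by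
    intro v y μ h0 h1 hy hyv hle
    have h1' : 0 < 1 - μ := sub_pos.2 h1
    have hle' : vol (K ∩ ({z + μ • v} - L)) ≤ vol (μ • y +ᵥ (1 - μ) • K) := by
      rw [hFvol, vol_vadd_smul h1'.le]
      exact mul_le_mul_of_nonneg_right (pow_le_pow_left₀ (hF0 _) hle n) hKpos.le
    have hs := hsub v y μ h0 h1.le hy hyv
    have hcomp := isCompact_inter_singleton_sub hK hL (z + μ • v)
    refine eq_of_subset_of_vol_le ((hK.smul (1 - μ)).vadd (μ • y)) hcomp
      (hKc.inter ((convex_singleton _).sub hLc)) ?_ hs hle'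
    refine lt_of_lt_of_le ?_ (vol_mono hcomp hs)
    rw [vol_vadd_smul h1'.le]
    positivity
  intro e he e' he' hne
  set v := e' - e with hv
  have hv0 : v ≠ 0 := sub_ne_zero.2 hne.symm
  have he'v : e' - v = e := by simp [hv]
  have hFv : F v = 0 := by
    by_contra hpos'
    have hpos : 0 < F v := lt_of_le_of_ne (hF0 v) (Ne.symm hpos')
    rcases (hF1 v).eq_or_lt with h1 | h1
    · have hvK := hFvol v
      rw [h1, one_pow, one_mul] at hvK
      have heq := eq_of_subset_of_vol_le (isCompact_inter_singleton_sub hK hL (z + v)) hK hKc hKpos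
        inter_subset_left hvK.ge
      refine hv0 (neg_eq_zero.1 (eq_zero_of_forall_add_mem hK hKne fun k hk => ?_))
      rw [← heq] at hk
      rw [← sub_eq_add_neg]
      exact (mem_inter_singleton_sub_iff.1 hk).2
    · obtain ⟨x, hx, x', hx', hxv⟩ := hlevel v (F v) ⟨hF0 v, h1⟩ le_rfl hpos
      have h1' : 0 < 1 - F v := sub_pos.2 h1
      have hh := hhom (x - x') x (1 - F v) h1'.le (by linarith) hx (by simpa using hx')
        (by rw [← hxv]; simp)
      rw [← hxv] at hh
      have hm : e' ∈ K ∩ ({z + v} - L) := mem_inter_singleton_sub_iff.2 ⟨he'.1, by rw [he'v]; exact he.1⟩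
      rw [← hh] at hm
      obtain ⟨_, ⟨k, hk, rfl⟩, hke⟩ := hm
      simp only [vadd_eq_add] at hke
      have hxe : x = e' := he'.2 hx hk
        ⟨1 - F v, 1 - (1 - F v), h1', by linarith, by ring, hke⟩
      have hee : e' = e := he.2 he'.1 hx' ⟨F v, 1 - F v, hpos, h1', by ring, by
        rw [hxe] at hxv
        have : e = e' - (1 - F v) • (e' - x') := by rw [← hxv, he'v]
        rw [this]
        module⟩
      exact hne hee.symm
  have hnot : ∀ x ∈ K, ∀ x' ∈ K, ∀ r : ℝ, 0 ≤ r → r < 1 → v ≠ r • (x - x') := by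
    intro x hx x' hx' r h0 h1 h
    have := hFconc x hx x' hx' r ⟨h0, h1.le⟩
    rw [← h, hFv] at this
    linarith
  have hFμ : ∀ μ : ℝ, 0 ≤ μ → μ ≤ 1 → F (μ • v) ≤ 1 - μ := by
    intro μ h0 h1
    rcases h0.eq_or_lt with rfl | h0
    · simpa using hF1 _
    by_contra! hlt
    have hFp : 0 < F (μ • v) := (sub_nonneg.2 h1).trans_lt hlt
    obtain ⟨t, ht1, ht2⟩ := exists_between (lt_min hlt (show 1 - μ < 1 by linarith))
    obtain ⟨x, hx, x', hx', hxv⟩ := hlevel (μ • v) t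
      ⟨by linarith, ht2.trans_le (min_le_right _ _)⟩ (ht2.le.trans (min_le_left _ _)) hFp
    have ht3 : t < 1 := ht2.trans_le (min_le_right _ _)
    refine hnot x hx x' hx' ((1 - t) / μ) (div_nonneg (by linarith) h0.le)
      ((div_lt_one h0).2 (by linarith)) ?_
    rw [div_eq_inv_mul, mul_smul, ← hxv, inv_smul_smul₀ h0.ne']
  intro μ hμ0 y hy hyv
  have hμ1 : μ ≤ 1 := by
    by_contra! hμ
    have hμpos : 0 < μ := by linarith
    refine hnot y hy (y - μ • v) hyv μ⁻¹ (by positivity) (inv_lt_one_of_one_lt₀ hμ) ?_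
    rw [sub_sub_cancel, inv_smul_smul₀ hμpos.ne']
  refine ⟨hμ1, ?_⟩
  rcases hμ1.eq_or_lt with rfl | hμlt
  · -- compare the homothets of ratio one half with centres `y` and `e'`
    rw [one_smul] at hyv
    have hh := hhom v e' (1 / 2) (by norm_num) (by norm_num) he'.1 (by rw [he'v]; exact he.1)
      (hFμ _ (by norm_num) (by norm_num))
    have hs := hsub v y (1 / 2) (by norm_num) (by norm_num) hy hyv
    rw [← hh] at hs
    have hye : y - e' = 0 := by
      refine eq_zero_of_forall_add_mem hK hKne fun k hk => ?_
      obtain ⟨_, ⟨l, hl, rfl⟩, hkl⟩ := hs ⟨_, ⟨k, hk, rfl⟩, rfl⟩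
      simp only [vadd_eq_add] at hkl
      have : k + (y - e') = l := by
        have h2 := congrArg (fun u => (2 : ℝ) • u - e') hkl
        have e1 : (2 : ℝ) • ((1 / 2 : ℝ) • e' + (1 - 1 / 2 : ℝ) • l) - e' = l := by module
        have e2 : (2 : ℝ) • ((1 / 2 : ℝ) • y + (1 - 1 / 2 : ℝ) • k) - e' = k + (y - e') := by
          module
        rw [← e1, ← e2, h2]
      rwa [this]
    exact ⟨e', he'.1, by rw [sub_eq_zero.1 hye]; simp⟩
  · have hh := hhom v e' μ hμ0 hμlt he'.1 (by rw [he'v]; exact he.1) (hFμ μ hμ0 hμ1)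
    have hm : y ∈ K ∩ ({z + μ • v} - L) := mem_inter_singleton_sub_iff.2 ⟨hy, hyv⟩
    rw [← hh] at hm
    obtain ⟨_, ⟨k, hk, rfl⟩, hky⟩ := hm
    exact ⟨k, hk, hky.symm.trans (add_comm _ _)⟩

end Simplex

/-! ### Simplices -/

section SimplexOverlap

variable {n : ℕ} {K L : Set (EuclideanSpace ℝ (Fin n))}

/-- The sum of the positive parts of the barycentric coordinates of the vector `w`. It is the gauge
of the difference body of the simplex spanned by `b`. -/
noncomputable def simplexGauge {ι : Type*} [Fintype ι]
    (b : AffineBasis ι ℝ (EuclideanSpace ℝ (Fin n))) (w : EuclideanSpace ℝ (Fin n)) : ℝ :=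
  ∑ i, max 0 ((b.coord i).linear w)

theorem simplexGauge_smul {ι : Type*} [Fintype ι]
    (b : AffineBasis ι ℝ (EuclideanSpace ℝ (Fin n))) {r : ℝ} (hr : 0 ≤ r)
    (w : EuclideanSpace ℝ (Fin n)) : simplexGauge b (r • w) = r * simplexGauge b w := by
  rw [simplexGauge, simplexGauge, Finset.mul_sum]
  refine Finset.sum_congr rfl fun i _ => ?_
  rw [map_smul, smul_eq_mul, mul_max_of_nonneg _ _ hr, mul_zero]

theorem AffineBasis.sum_coord_linear_smul {ι : Type*} [Fintype ι]
    (b : AffineBasis ι ℝ (EuclideanSpace ℝ (Fin n))) (w : EuclideanSpace ℝ (Fin n)) :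
    ∑ i, (b.coord i).linear w • b i = w ∧ ∑ i, (b.coord i).linear w = 0 := by
  have h1 := b.linear_combination_coord_eq_self w
  have h2 := b.linear_combination_coord_eq_self 0
  have h3 := b.sum_coord_apply_eq_one w
  have h4 := b.sum_coord_apply_eq_one 0
  have hlin : ∀ i, (b.coord i).linear w = b.coord i w - b.coord i 0 := fun i => by
    have := (b.coord i).linearMap_vsub w 0
    simpa using this
  simp only [hlin, sub_smul, Finset.sum_sub_distrib, h1, h2, h3, h4, sub_zero, sub_self, and_self]

/-- In barycentric coordinates an intersection of two translates of a simplex prescribes lower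
bounds for the coordinates, so it is again a homothet of the simplex. -/
theorem vol_inter_of_affineBasis {ι : Type*} [Fintype ι]
    (b : AffineBasis ι ℝ (EuclideanSpace ℝ (Fin n))) (hb : K = convexHull ℝ (range b))
    (z w : EuclideanSpace ℝ (Fin n)) :
    ((K ∩ ({z + w} - ({z} - K))).Nonempty ↔ simplexGauge b w ≤ 1) ∧
      (simplexGauge b w ≤ 1 →
        vol (K ∩ ({z + w} - ({z} - K))) = (1 - simplexGauge b w) ^ n * vol K) := by
  have hK : ∀ y, y ∈ K ↔ ∀ i, 0 ≤ b.coord i y := by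
    intro y
    rw [hb, b.convexHull_eq_nonneg_coord]
    rfl
  have hKc : Convex ℝ K := hb ▸ convex_convexHull ℝ _
  have hbK : ∀ i, b i ∈ K := fun i => hb ▸ subset_convexHull ℝ _ (mem_range_self i)
  have hKne : K.Nonempty := ⟨_, hbK b.nonempty.some⟩
  obtain ⟨hw1, hw2⟩ := b.sum_coord_linear_smul w
  set σ := simplexGauge b w with hσ
  set m : ι → ℝ := fun i => max 0 ((b.coord i).linear w) with hm
  have hmσ : ∑ i, m i = σ := rfl
  have hm0 : ∀ i, 0 ≤ m i := fun i => le_max_left _ _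
  have hmem : ∀ y ∈ K ∩ ({z + w} - ({z} - K)), ∀ i, m i ≤ b.coord i y := by
    intro y hy i
    rw [mem_inter_singleton_sub_iff, hK, hK] at hy
    refine max_le (hy.1 i) ?_
    have h2 := hy.2 i
    have hlin : (b.coord i).linear w = b.coord i y - b.coord i (y - w) := by
      have := (b.coord i).linearMap_vsub y (y - w)
      simpa using this
    linarith
  have hsum : ∀ y ∈ K ∩ ({z + w} - ({z} - K)), σ ≤ 1 := by
    intro y hy
    rw [← b.sum_coord_apply_eq_one y, ← hmσ]
    exact Finset.sum_le_sum fun i _ => hmem y hy i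
  have hP : InCone K (∑ i, m i • b i) σ :=
    InCone.sum hKc hKne Finset.univ b m (fun i _ => hbK i) (fun i _ => hm0 i)
  have heq : σ ≤ 1 → K ∩ ({z + w} - ({z} - K)) = (∑ i, m i • b i) +ᵥ (1 - σ) • K := by
    intro h1
    ext y
    constructor
    · intro hy
      obtain ⟨-, k, hk, hk'⟩ := InCone.sum hKc hKne Finset.univ b (fun i => b.coord i y - m i)
        (fun i _ => hbK i) (fun i _ => sub_nonneg.2 (hmem y hy i))
      simp only [sub_smul, Finset.sum_sub_distrib, b.linear_combination_coord_eq_self,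
        b.sum_coord_apply_eq_one, hmσ] at hk'
      refine ⟨_, ⟨k, hk, rfl⟩, ?_⟩
      simp only [vadd_eq_add]
      rw [sub_smul, ← hk']
      abel
    · rintro ⟨_, ⟨k, hk, rfl⟩, rfl⟩
      have hk' : InCone K ((1 - σ) • k) (1 - σ) := InCone.smul_mem (sub_nonneg.2 h1) hk
      rw [mem_inter_singleton_sub_iff]
      have hone : ∀ u, InCone K u 1 → u ∈ K := by
        rintro u ⟨-, l, hl, rfl⟩
        simpa using hl
      refine ⟨hone _ ?_, hone _ ?_⟩
      · have := hP.add hKc hk'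
        rwa [add_sub_cancel] at this
      · have hQ := InCone.sum hKc hKne Finset.univ b (fun i => m i - (b.coord i).linear w)
          (fun i _ => hbK i) (fun i _ => sub_nonneg.2 (le_max_right _ _))
        simp only [sub_smul, Finset.sum_sub_distrib, hw1, hw2, hmσ, sub_zero] at hQ
        have := hQ.add hKc hk'
        rw [add_sub_cancel] at this
        convert this using 1
        simp only [vadd_eq_add]
        abel
  refine ⟨⟨fun ⟨y, hy⟩ => hsum y hy, fun h1 => ?_⟩, fun h1 => ?_⟩
  · rw [heq h1]
    exact hKne.smul_set.vadd_set
  · rw [heq h1, vol_vadd_smul (sub_nonneg.2 h1)]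

/-- The convolution bodies of a simplex `K` and `z - K` are dilates of the difference body. -/
theorem IsFullSimplex.vol_overlapLevel (hn : 1 ≤ n) (hK : IsCompact K)
    (hK' : (interior K).Nonempty) (hS : IsFullSimplex K) (z : EuclideanSpace ℝ (Fin n)) {t : ℝ}
    (ht : t ∈ Ico (0 : ℝ) 1) :
    vol (overlapLevel K ({z} - K) t) = (1 - t) ^ n * vol (K + ({z} - K)) := by
  obtain ⟨S, hS⟩ := hS
  let b : AffineBasis (Fin (n + 1)) ℝ (EuclideanSpace ℝ (Fin n)) :=
    ⟨S.points, S.independent, S.independent.affineSpan_eq_top_iff_card_eq_finrank_add_one.2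
      (by simp)⟩
  have hb : K = convexHull ℝ (range b) := hS
  have hKpos := vol_pos_of_interior hK hK'
  have hlevel : ∀ t ∈ Ico (0 : ℝ) 1,
      overlapLevel K ({z} - K) t = z +ᵥ (1 - t) • {w | simplexGauge b w ≤ 1} := by
    intro t ht
    have ht' : 0 < 1 - t := sub_pos.2 ht.2
    have hmem : ∀ w, z + w ∈ overlapLevel K ({z} - K) t ↔ simplexGauge b w ≤ 1 - t := by
      intro w
      obtain ⟨h1, h2⟩ := vol_inter_of_affineBasis b hb z w
      rw [overlapLevel, mem_ofPred_eq, ← inter_singleton_sub_nonempty, h1]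
      have hrel : simplexGauge b w ≤ 1 →
          relOverlap K ({z} - K) (z + w) = 1 - simplexGauge b w := by
        intro h
        rw [relOverlap, h2 h, maxIntersectionVol_singleton_sub hK z,
          mul_div_cancel_right₀ _ hKpos.ne', one_div,
          Real.pow_rpow_inv_natCast (sub_nonneg.2 h) (by omega)]
      constructor
      · rintro ⟨h, h'⟩
        rw [hrel h] at h'
        linarith
      · intro h
        have h3 : simplexGauge b w ≤ 1 := by linarith [ht.1]
        refine ⟨h3, ?_⟩
        rw [hrel h3]
        linarith
    ext u
    obtain ⟨w, rfl⟩ : ∃ w, u = z + w := ⟨u - z, by abel⟩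
    rw [hmem]
    change _ ↔ z +ᵥ w ∈ _
    rw [vadd_mem_vadd_set_iff, mem_smul_set_iff_inv_smul_mem₀ ht'.ne', mem_ofPred_eq,
      simplexGauge_smul b (by positivity), inv_mul_le_iff₀ ht', mul_one]
  rw [← overlapLevel_zero, hlevel t ht, hlevel 0 (by simp), sub_zero, one_smul, vol_vadd,
    vol_smul (sub_nonneg.2 ht.2.le), vol_vadd]

end SimplexOverlap

/-! ### Volume bounds for convolution bodies -/

section VolumeBounds

variable {n : ℕ} {K L : Set (EuclideanSpace ℝ (Fin n))}

/-- The quotient `|K| |L| / M(K, L)` dominates both volumes, hence the `n`-th power of the mean of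
their `n`-th roots, with equality only if both volumes equal the maximal intersection volume. -/
theorem mean_rpow_vol_le (hn : 1 ≤ n) (hK : IsCompact K) (hL : IsCompact L)
    (hK' : (interior K).Nonempty) (hL' : (interior L).Nonempty) :
    (vol K ^ (1 / (n : ℝ)) + vol L ^ (1 / (n : ℝ))) / 2 ≤
      (vol K * vol L / maxIntersectionVol K L) ^ (1 / (n : ℝ)) ∧
    ((vol K ^ (1 / (n : ℝ)) + vol L ^ (1 / (n : ℝ))) / 2 =
      (vol K * vol L / maxIntersectionVol K L) ^ (1 / (n : ℝ)) →
      vol K = maxIntersectionVol K L ∧ vol L = maxIntersectionVol K L) := by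
  have hM := maxIntersectionVol_pos hK hK' hL'
  have hKpos := vol_pos_of_interior hK hK'
  have hLpos := vol_pos_of_interior hL hL'
  have hMK : maxIntersectionVol K L ≤ vol K :=
    ciSup_le fun z => vol_inter_singleton_sub_le_left hK z
  have hML : maxIntersectionVol K L ≤ vol L :=
    ciSup_le fun z => vol_inter_singleton_sub_le_right hL z
  have hn' : (0 : ℝ) < 1 / n := by positivity
  have hKI : vol K ≤ vol K * vol L / maxIntersectionVol K L := by
    rw [le_div_iff₀ hM]
    exact mul_le_mul_of_nonneg_left hML hKpos.le
  have hLI : vol L ≤ vol K * vol L / maxIntersectionVol K L := by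
    rw [le_div_iff₀ hM, mul_comm]
    exact mul_le_mul_of_nonneg_right hMK hLpos.le
  have hI0 : 0 ≤ vol K * vol L / maxIntersectionVol K L := hKpos.le.trans hKI
  have h1 := Real.rpow_le_rpow hKpos.le hKI hn'.le
  have h2 := Real.rpow_le_rpow hLpos.le hLI hn'.le
  refine ⟨by linarith, fun h => ?_⟩
  have e1 := (Real.rpow_left_inj hKpos.le hI0 hn'.ne').1 (by linarith)
  have e2 := (Real.rpow_left_inj hLpos.le hI0 hn'.ne').1 (by linarith)
  rw [eq_div_iff hM.ne'] at e1 e2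
  refine ⟨?_, ?_⟩
  · apply mul_left_cancel₀ hLpos.ne'
    linarith
  · apply mul_left_cancel₀ hKpos.ne'
    linarith

/-- The body at level `sⁿ`, `s ≥ 3 / 4`, compared with the mean of the `n`-th roots of the volumes;
in the case of equality `K` is a translate of `-L` and the bodies at all levels shrink linearly. -/
theorem levelRadius_ge (hn : 1 ≤ n) (hK : IsCompact K) (hL : IsCompact L)
    (hKc : Convex ℝ K) (hLc : Convex ℝ L) (hK' : (interior K).Nonempty)
    (hL' : (interior L).Nonempty) {s : ℝ} (hs : 3 / 4 ≤ s) (hs1 : s < 1) :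
    1 / 2 * ((2 * n).choose n : ℝ) ^ (1 / (n : ℝ)) * (1 - s) *
      (vol K ^ (1 / (n : ℝ)) + vol L ^ (1 / (n : ℝ))) ≤ levelRadius K L s ∧
    (levelRadius K L s = 1 / 2 * ((2 * n).choose n : ℝ) ^ (1 / (n : ℝ)) * (1 - s) *
      (vol K ^ (1 / (n : ℝ)) + vol L ^ (1 / (n : ℝ))) →
      (∃ z, L = {z} - K) ∧
        ∀ t ∈ Icc (0 : ℝ) 1, vol (overlapLevel K L t) = (1 - t) ^ n * vol (K + L)) := by
  obtain ⟨hA, hA'⟩ := integral_pow_le_of_concaveOn hn (concaveOn_levelRadius hn hK hL hKc hLc hK' hL')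
    ((levelRadius_antitone hK hL).antitoneOn _) (fun t _ => levelRadius_nonneg t) hs hs1
  obtain ⟨hB, hB'⟩ := mean_rpow_vol_le hn hK hL hK' hL'
  rw [integral_levelRadius hn hK hL hK' hL'] at hA hA'
  have hM := maxIntersectionVol_pos hK hK' hL'
  have hKpos := vol_pos_of_interior hK hK'
  have hLpos := vol_pos_of_interior hL hL'
  set I := vol K * vol L / maxIntersectionVol K L with hI
  set C : ℝ := ((2 * n).choose n : ℝ) with hC
  set m := vol K ^ (1 / (n : ℝ)) + vol L ^ (1 / (n : ℝ)) with hm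
  have hs1' : 0 < 1 - s := sub_pos.2 hs1
  have hn' : (0 : ℝ) < 1 / n := by positivity
  have hIpos : 0 < I := by positivity
  have hmpos : 0 < m := by positivity
  have hCpos : 0 < C := by
    rw [hC]; exact_mod_cast Nat.choose_pos (by omega)
  have hCn : 0 < C ^ (1 / (n : ℝ)) := Real.rpow_pos_of_pos hCpos _
  set c := levelRadius K L s / (1 - s) with hc
  have hc0 : 0 ≤ c := div_nonneg (levelRadius_nonneg s) hs1'.le
  have hrs : levelRadius K L s = c * (1 - s) := (div_mul_cancel₀ _ hs1'.ne').symm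
  have hroot : (c ^ n * (1 / C)) ^ (1 / (n : ℝ)) = c / C ^ (1 / (n : ℝ)) := by
    rw [mul_one_div, Real.div_rpow (by positivity) hCpos.le, one_div,
      Real.pow_rpow_inv_natCast hc0 (by omega)]
  have hIc : I ^ (1 / (n : ℝ)) ≤ c / C ^ (1 / (n : ℝ)) := by
    rw [← hroot]
    exact Real.rpow_le_rpow hIpos.le hA hn'.le
  have hmc : m / 2 ≤ c / C ^ (1 / (n : ℝ)) := hB.trans hIc
  refine ⟨?_, fun heq => ?_⟩
  · rw [le_div_iff₀ hCn] at hmc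
    rw [hrs]
    calc 1 / 2 * C ^ (1 / (n : ℝ)) * (1 - s) * m = m / 2 * C ^ (1 / (n : ℝ)) * (1 - s) := by ring
      _ ≤ c * (1 - s) := mul_le_mul_of_nonneg_right hmc hs1'.le
  · have hceq : c = m / 2 * C ^ (1 / (n : ℝ)) := by
      apply mul_right_cancel₀ hs1'.ne'
      rw [← hrs, heq]
      ring
    have hmc' : m / 2 = c / C ^ (1 / (n : ℝ)) := by rw [hceq, mul_div_cancel_right₀ _ hCn.ne']
    have hIeq : I = c ^ n * (1 / C) := by
      refine (Real.rpow_left_inj hIpos.le (by positivity) hn'.ne').1 ?_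
      rw [hroot]
      exact le_antisymm hIc (hmc' ▸ hB)
    have hcpos : 0 < c := by rw [hceq]; positivity
    have hlin := hA' (by rw [hrs]; positivity) hIeq
    obtain ⟨hKM, hLM⟩ := hB' (le_antisymm hB (hmc'.symm ▸ hIc))
    obtain ⟨z, -, hz⟩ := exists_vol_inter_eq_max hK hL hK' hL'
    refine ⟨⟨z, ?_⟩, fun t ht => ?_⟩
    · have hcomp := isCompact_inter_singleton_sub hK hL z
      have e1 : K ∩ ({z} - L) = K := eq_of_subset_of_vol_le hcomp hK hKc hKpos inter_subset_left
        (by rw [hz, hKM])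
      have e2 : K ∩ ({z} - L) = {z} - L := eq_of_subset_of_vol_le hcomp
        (isCompact_singleton_sub hL z) ((convex_singleton z).sub hLc)
        (by rwa [vol_singleton_sub]) inter_subset_right (by rw [hz, vol_singleton_sub, hLM])
      have e3 : K = {z} - L := e1.symm.trans e2
      ext y
      rw [mem_singleton_sub, e3, mem_singleton_sub, sub_sub_cancel]
    · have h0 := hlin 0 (by simp)
      rw [← levelRadius_pow hn, hlin t ht, ← overlapLevel_zero, ← levelRadius_pow hn, h0,
        sub_zero, mul_one, mul_pow, mul_comm]

/-- If the convolution bodies shrink linearly, then the layer-cake identity determines the volume of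
`K + L`. -/
theorem vol_add_eq_choose_mul (hn : 1 ≤ n) (hK : IsCompact K) (hL : IsCompact L)
    (hK' : (interior K).Nonempty) (hL' : (interior L).Nonempty)
    (hvol : ∀ t ∈ Ico (0 : ℝ) 1, vol (overlapLevel K L t) = (1 - t) ^ n * vol (K + L)) :
    vol (K + L) = (2 * n).choose n * (vol K * vol L / maxIntersectionVol K L) := by
  rw [← integral_levelRadius hn hK hL hK' hL', intervalIntegral.integral_congr_Ioo_of_le
    (g := fun t => n * t ^ (n - 1) * (1 - t) ^ n * vol (K + L)) zero_le_one
    (fun t ht => by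
      simp only [levelRadius_pow hn]
      rw [hvol t ⟨ht.1.le, ht.2⟩]
      ring),
    intervalIntegral.integral_mul_const, integral_beta_choose hn]
  have : ((2 * n).choose n : ℝ) ≠ 0 := by exact_mod_cast (Nat.choose_pos (by omega)).ne'
  field_simp

theorem levelRadius_eq_of_isFullSimplex (hn : 1 ≤ n) (hK : IsCompact K)
    (hK' : (interior K).Nonempty) (hS : IsFullSimplex K) (z : EuclideanSpace ℝ (Fin n))
    (hL' : (interior ({z} - K)).Nonempty) {s : ℝ} (hs : s ∈ Ico (0 : ℝ) 1) :
    levelRadius K ({z} - K) s = 1 / 2 * ((2 * n).choose n : ℝ) ^ (1 / (n : ℝ)) * (1 - s) *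
      (vol K ^ (1 / (n : ℝ)) + vol ({z} - K) ^ (1 / (n : ℝ))) := by
  have hKpos := vol_pos_of_interior hK hK'
  have hvol := fun t ht => hS.vol_overlapLevel hn hK hK' z (t := t) ht
  have hadd := vol_add_eq_choose_mul hn hK (isCompact_singleton_sub hK z) hK' hL' hvol
  rw [maxIntersectionVol_singleton_sub hK z, vol_singleton_sub,
    mul_div_cancel_right₀ _ hKpos.ne'] at hadd
  rw [levelRadius, hvol s hs, hadd, vol_singleton_sub,
    Real.mul_rpow (pow_nonneg (sub_nonneg.2 hs.2.le) n) (by positivity),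
    Real.mul_rpow (by positivity) hKpos.le, one_div,
    Real.pow_rpow_inv_natCast (sub_nonneg.2 hs.2.le) (by omega)]
  ring

end VolumeBounds

theorem eq_vadd_neg_iff {n : ℕ} {K L : Set (EuclideanSpace ℝ (Fin n))}
    (x : EuclideanSpace ℝ (Fin n)) : K = x +ᵥ (-L) ↔ L = {x} - K := by
  have h : x +ᵥ (-L) = {x} - L := by
    rw [sub_eq_add_neg, singleton_add]
    rfl
  rw [h]
  constructor <;> rintro rfl <;> ext y <;>
    rw [mem_singleton_sub, mem_singleton_sub, sub_sub_cancel]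

theorem theorem1p1 (n : ℕ) (hn : 1 ≤ n) (K L : ConvexBody (EuclideanSpace ℝ (Fin n)))
    (hK : (interior (K : Set (EuclideanSpace ℝ (Fin n)))).Nonempty)
    (hL : (interior (L : Set (EuclideanSpace ℝ (Fin n)))).Nonempty) :
    (∀ θ : ℝ, (3 / 4 : ℝ) ^ n ≤ θ → θ ≤ 1 →
      1 / 2 * ((2 * n).choose n : ℝ) ^ (1 / (n : ℝ)) * (1 - θ ^ (1 / (n : ℝ))) *
          (vol (K : Set (EuclideanSpace ℝ (Fin n))) ^ (1 / (n : ℝ)) +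
            vol (L : Set (EuclideanSpace ℝ (Fin n))) ^ (1 / (n : ℝ)))
        ≤ vol (thetaConvolution θ (K : Set (EuclideanSpace ℝ (Fin n))) L) ^ (1 / (n : ℝ))) ∧
    (∀ θ : ℝ, 0 ≤ θ → θ ≤ (3 / 4 : ℝ) ^ n →
      (1 - (4 / 3 - 1 / 6 * ((2 * n).choose n : ℝ) ^ (1 / (n : ℝ))) * θ ^ (1 / (n : ℝ))) *
          (vol (K : Set (EuclideanSpace ℝ (Fin n))) ^ (1 / (n : ℝ)) +
            vol (L : Set (EuclideanSpace ℝ (Fin n))) ^ (1 / (n : ℝ)))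
        ≤ vol (thetaConvolution θ (K : Set (EuclideanSpace ℝ (Fin n))) L) ^ (1 / (n : ℝ))) ∧
    (∀ θ : ℝ, (3 / 4 : ℝ) ^ n ≤ θ → θ < 1 →
      (vol (thetaConvolution θ (K : Set (EuclideanSpace ℝ (Fin n))) L) ^ (1 / (n : ℝ)) =
          1 / 2 * ((2 * n).choose n : ℝ) ^ (1 / (n : ℝ)) * (1 - θ ^ (1 / (n : ℝ))) *
            (vol (K : Set (EuclideanSpace ℝ (Fin n))) ^ (1 / (n : ℝ)) +
              vol (L : Set (EuclideanSpace ℝ (Fin n))) ^ (1 / (n : ℝ)))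
        ↔ (∃ x : EuclideanSpace ℝ (Fin n),
              (K : Set (EuclideanSpace ℝ (Fin n))) = x +ᵥ (-(L : Set (EuclideanSpace ℝ (Fin n))))) ∧
            IsFullSimplex (K : Set (EuclideanSpace ℝ (Fin n))))) := by
  have cK := K.isCompact
  have cL := L.isCompact
  have vK := K.convex
  have vL := L.convex
  have hM := maxIntersectionVol_pos cK hK hL
  have hn' : (0 : ℝ) < 1 / n := by positivity
  have hpow : (0 : ℝ) ≤ (3 / 4) ^ n := by positivity
  have hconv : ∀ θ : ℝ, 0 ≤ θ →
      vol (thetaConvolution θ (K : Set (EuclideanSpace ℝ (Fin n))) L) ^ (1 / (n : ℝ)) =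
        levelRadius (K : Set (EuclideanSpace ℝ (Fin n))) L (θ ^ (1 / (n : ℝ))) := fun θ hθ => by
    rw [thetaConvolution_eq_overlapLevel hn hM hθ, levelRadius]
  have hroot : ((3 / 4 : ℝ) ^ n) ^ (1 / (n : ℝ)) = 3 / 4 := by
    rw [one_div, Real.pow_rpow_inv_natCast (by norm_num) (by omega)]
  have hge : ∀ θ : ℝ, (3 / 4 : ℝ) ^ n ≤ θ → 3 / 4 ≤ θ ^ (1 / (n : ℝ)) := fun θ hθ => by
    rw [← hroot]
    exact Real.rpow_le_rpow hpow hθ hn'.le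
  refine ⟨fun θ h1 h2 => ?_, fun θ h1 h2 => ?_, fun θ h1 h2 => ?_⟩
  · rw [hconv θ (hpow.trans h1)]
    rcases h2.eq_or_lt with rfl | h2
    · rw [Real.one_rpow, sub_self, mul_zero, zero_mul]
      exact levelRadius_nonneg _
    · exact (levelRadius_ge hn cK cL vK vL hK hL (hge θ h1)
        (Real.rpow_lt_one (hpow.trans h1) h2 hn')).1
  · -- interpolate between the Brunn–Minkowski inequality and the bound at the level `3 / 4`
    rw [hconv θ h1]
    set u := θ ^ (1 / (n : ℝ)) with hu
    have hu0 : 0 ≤ u := Real.rpow_nonneg h1 _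
    have hu1 : u ≤ 3 / 4 := by
      rw [← hroot]
      exact Real.rpow_le_rpow h1 h2 hn'.le
    have hzero := brunn_minkowski hn cK cL (hK.mono interior_subset) (hL.mono interior_subset)
    rw [← overlapLevel_zero] at hzero
    change _ ≤ levelRadius _ _ 0 at hzero
    have hend := (levelRadius_ge hn cK cL vK vL hK hL le_rfl (by norm_num : (3 / 4 : ℝ) < 1)).1
    have hconc := (concaveOn_levelRadius hn cK cL vK vL hK hL).2
      (show (0 : ℝ) ∈ Icc (0 : ℝ) 1 by simp)
      (show (3 / 4 : ℝ) ∈ Icc (0 : ℝ) 1 by constructor <;> norm_num)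
      (show 0 ≤ 1 - 4 / 3 * u by linarith) (show 0 ≤ 4 / 3 * u by positivity) (by ring)
    simp only [smul_eq_mul, mul_zero, zero_add] at hconc
    rw [show 4 / 3 * u * (3 / 4) = u by ring] at hconc
    have i1 := mul_le_mul_of_nonneg_left hzero (show 0 ≤ 1 - 4 / 3 * u by linarith)
    have i2 := mul_le_mul_of_nonneg_left hend (show 0 ≤ 4 / 3 * u by positivity)
    refine le_trans (le_of_eq ?_) ((add_le_add i1 i2).trans hconc)
    ring
  · rw [hconv θ (hpow.trans h1)]
    have hs1 := Real.rpow_lt_one (hpow.trans h1) h2 hn'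
    constructor
    · intro heq
      obtain ⟨⟨z, hz⟩, hvol⟩ := (levelRadius_ge hn cK cL vK vL hK hL (hge θ h1) hs1).2 heq
      refine ⟨⟨z, (eq_vadd_neg_iff z).2 hz⟩, ?_⟩
      rw [hz] at hvol
      exact (homotheticAtExtremePoints_of_vol_overlapLevel hn cK vK hK z
        fun t ht => hvol t ⟨ht.1, ht.2.le⟩).isFullSimplex cK vK hK
    · rintro ⟨⟨x, hx⟩, hS⟩
      rw [eq_vadd_neg_iff] at hx
      rw [hx] at hL ⊢
      exact levelRadius_eq_of_isFullSimplex hn cK hK hS x hL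
        ⟨le_trans (by norm_num) (hge θ h1), hs1⟩
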